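/- Call a finite set $X$ of unit vectors in a Euclidean space $\mathbb{R}^d$ an equiangular set if there is $\alpha\in[0,1)$ such that $\langle x,y\rangle\in\{\alpha,-\alpha\}$ for all distinct $x,y\in X$; since $\alpha<1$, its elements span $|X|$ distinct lines, any two of which form the same angle $\arccos\alpha$. The rank of $X$ is the dimension of its linear span. For a positive integer $r$ let $M^*(r)$ be the maximum cardinality of an equiangular set of rank exactly $r$ (in a Euclidean space $\mathbb{R}^d$ of any dimension $d$). Then $$M^*(8)=14,\qquad M^*(9)=18,\qquad M^*(10)=18.$$ -/

import Mathlib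

/-- `X` is an equiangular set with angle `α`: a finite set of unit vectors of `ℝ^d` such that any
two distinct members have inner product `α` or `-α`. -/
def IsEquiangularWith {d : ℕ} (α : ℝ) (X : Finset (EuclideanSpace ℝ (Fin d))) : Prop :=
  (∀ x ∈ X, ‖x‖ = 1) ∧
    ∀ x ∈ X, ∀ y ∈ X, x ≠ y → inner ℝ x y = α ∨ inner ℝ x y = -α

/-- `X` is an equiangular set: it is equiangular with angle `α` for some `α ∈ [0, 1)`.
As `α < 1`, distinct members of `X` span distinct lines. -/
def IsEquiangular {d : ℕ} (X : Finset (EuclideanSpace ℝ (Fin d))) : Prop :=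
  ∃ α : ℝ, 0 ≤ α ∧ α < 1 ∧ IsEquiangularWith α X

/-- The rank of a finite set of vectors: the dimension of its span (the rank of its Gram
matrix). -/
noncomputable def vectorRank {d : ℕ} (X : Finset (EuclideanSpace ℝ (Fin d))) : ℕ :=
  Module.finrank ℝ (Submodule.span ℝ (X : Set (EuclideanSpace ℝ (Fin d))))

/-- The set of all cardinalities of equiangular sets of rank exactly `r`, in Euclidean spaces
`ℝ^d` of any dimension `d`. The number `M*(r)` is the greatest element of this set. -/
def equiangularSizes (r : ℕ) : Set ℕ :=
  {n | ∃ (d : ℕ) (X : Finset (EuclideanSpace ℝ (Fin d))),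
    IsEquiangular X ∧ vectorRank X = r ∧ X.card = n}

/-! The lower bounds are explicit. A regular tetrahedron in `ℝ³`, with two further vectors for each
of `k` extra dimensions, gives `4 + 2k` lines of rank `3 + k`; `k = 5` and `k = 7` serve ranks 8 and
10. For rank 9 this gives only 16, and the 18 lines come from the Paley conference matrix of order
18.

For the upper bounds, take `m = 7` for rank 8 and `m = 9` for ranks 9 and 10. A larger set would
contain `2m + 1` vectors of the same rank, at most `m + 1`. Their Gram matrix is `1 + αS` with `S` a
Seidel matrix, so `-1/α` is an eigenvalue of `S` of multiplicity at least `m`. Its minimal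
polynomial to the power `m` divides a characteristic polynomial of degree `2m + 1`, hence has degree
at most 2. Degree 2 is excluded by traces, parity and a handshake argument modulo 4, all using that
`m` is odd (`exists_odd_eq_of_le_finrank_eigenspace`). So `-1/α` is an integer; it is odd by a
determinant modulo 2, and the relative bound leaves only `-3`: thus `α = 1/3` (`angle_eq_third`).

With `α = 1/3` and rank `r ≥ 8` there are at most `2(r - 1)` vectors (`card_le_of_inner_eq_third`),
by the pillar method of Lemmens and Seidel. Unless the vectors are independent, their span contains
a regular tetrahedron. The vectors other than its vertices and their opposites fall, up to sign,
into three classes according to their projection on its span. Their rescaled components orthogonal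
to it have norm `√2` and integral inner products, and in dimension `r - 3 ≥ 5` number at most `2(r -
3)`. The tetrahedron adds at most 4. -/

/-! ### Vectors of norm `√2` in three classes, spanning at least five dimensions. -/

section RootVectors

variable {F : Type*} [NormedAddCommGroup F] [InnerProductSpace ℝ F]

/-- If `f` has inner product `±1` with four orthogonal vectors of norm `√2`, then the last of them
lies in the span of `f` and the others. -/
lemma mem_span_of_orthogonal_frame {e₁ e₂ e₃ f v : F}
    (h11 : inner ℝ e₁ e₁ = (2 : ℝ)) (h22 : inner ℝ e₂ e₂ = (2 : ℝ))
    (h33 : inner ℝ e₃ e₃ = (2 : ℝ)) (hff : inner ℝ f f = (2 : ℝ)) (hvv : inner ℝ v v = (2 : ℝ))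
    (h12 : inner ℝ e₁ e₂ = (0 : ℝ)) (h13 : inner ℝ e₁ e₃ = (0 : ℝ))
    (h23 : inner ℝ e₂ e₃ = (0 : ℝ)) (h1v : inner ℝ e₁ v = (0 : ℝ))
    (h2v : inner ℝ e₂ v = (0 : ℝ)) (h3v : inner ℝ e₃ v = (0 : ℝ))
    (h1f : inner ℝ e₁ f = (1 : ℝ) ∨ inner ℝ e₁ f = (-1 : ℝ))
    (h2f : inner ℝ e₂ f = (1 : ℝ) ∨ inner ℝ e₂ f = (-1 : ℝ))
    (h3f : inner ℝ e₃ f = (1 : ℝ) ∨ inner ℝ e₃ f = (-1 : ℝ))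
    (hvf : inner ℝ v f = (1 : ℝ) ∨ inner ℝ v f = (-1 : ℝ)) :
    v ∈ Submodule.span ℝ ({e₁, e₂, e₃, f} : Set F) := by
  have hsq : ∀ x : ℝ, x = 1 ∨ x = -1 → x ^ 2 = 1 := by rintro x (h | h) <;> rw [h] <;> norm_num
  set a := inner ℝ e₁ f with ha
  set b := inner ℝ e₂ f with hb
  set c := inner ℝ e₃ f with hc
  set d := inner ℝ v f with hd
  have ha2 := hsq _ h1f
  have hb2 := hsq _ h2f
  have hc2 := hsq _ h3f
  have hd2 := hsq _ hvf
  -- The four projections of `f` on the frame have total squared norm `4 · 1/2 = 2`, so `f` is half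
  -- the signed sum of the frame; solve for `v`.
  have key : v - d • ((2 : ℝ) • f - a • e₁ - b • e₂ - c • e₃) = 0 := by
    rw [← inner_self_eq_zero (𝕜 := ℝ)]
    simp only [inner_sub_left, inner_sub_right, inner_smul_left, inner_smul_right,
      RCLike.conj_to_real, real_inner_comm e₁ e₂, real_inner_comm e₁ e₃, real_inner_comm e₂ e₃,
      real_inner_comm e₁ v, real_inner_comm e₂ v, real_inner_comm e₃ v, real_inner_comm e₁ f,
      real_inner_comm e₂ f, real_inner_comm e₃ f, real_inner_comm v f, h11, h22, h33, hff, hvv,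
      h12, h13, h23, h1v, h2v, h3v, ← ha, ← hb, ← hc, ← hd]
    linear_combination (-2 * d ^ 2) * (ha2 + hb2 + hc2) - 2 * hd2
  rw [sub_eq_zero] at key
  rw [key]
  refine Submodule.smul_mem _ _ (sub_mem (sub_mem (sub_mem ?_ ?_) ?_) ?_) <;>
    exact Submodule.smul_mem _ _ (Submodule.subset_span (by simp))

/-- Off the span of the three `eᵢ`, both `v` and `f` leave remainders of squared norm `1/2`. The
inner product of these remainders is half an odd integer, so Cauchy–Schwarz forces `±1/2`: the
remainders agree up to sign. -/
lemma mem_span_of_transversal {e₁ e₂ e₃ f v : F}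
    (h11 : inner ℝ e₁ e₁ = (2 : ℝ)) (h22 : inner ℝ e₂ e₂ = (2 : ℝ))
    (h33 : inner ℝ e₃ e₃ = (2 : ℝ)) (hff : inner ℝ f f = (2 : ℝ)) (hvv : inner ℝ v v = (2 : ℝ))
    (h12 : inner ℝ e₁ e₂ = (0 : ℝ)) (h13 : inner ℝ e₁ e₃ = (0 : ℝ))
    (h23 : inner ℝ e₂ e₃ = (0 : ℝ))
    (h1v : inner ℝ e₁ v = (1 : ℝ) ∨ inner ℝ e₁ v = (-1 : ℝ))
    (h2v : inner ℝ e₂ v = (1 : ℝ) ∨ inner ℝ e₂ v = (-1 : ℝ))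
    (h3v : inner ℝ e₃ v = (1 : ℝ) ∨ inner ℝ e₃ v = (-1 : ℝ))
    (h1f : inner ℝ e₁ f = (1 : ℝ) ∨ inner ℝ e₁ f = (-1 : ℝ))
    (h2f : inner ℝ e₂ f = (1 : ℝ) ∨ inner ℝ e₂ f = (-1 : ℝ))
    (h3f : inner ℝ e₃ f = (1 : ℝ) ∨ inner ℝ e₃ f = (-1 : ℝ))
    (hvf : inner ℝ v f = (0 : ℝ) ∨ inner ℝ v f = (1 : ℝ) ∨ inner ℝ v f = (-1 : ℝ)) :
    v ∈ Submodule.span ℝ ({e₁, e₂, e₃, f} : Set F) := by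
  have hsq : ∀ x : ℝ, x = 1 ∨ x = -1 → x ^ 2 = 1 := by rintro x (h | h) <;> rw [h] <;> norm_num
  have hmul : ∀ x y : ℝ, x = 1 ∨ x = -1 → y = 1 ∨ y = -1 → x * y = 1 ∨ x * y = -1 := by
    rintro x y (h | h) (h' | h') <;> rw [h, h'] <;> norm_num
  set a := inner ℝ e₁ f with ha
  set b := inner ℝ e₂ f with hb
  set c := inner ℝ e₃ f with hc
  set t := inner ℝ v f with ht
  set x := inner ℝ e₁ v with hx
  set y := inner ℝ e₂ v with hy
  set z := inner ℝ e₃ v with hz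
  have ha2 := hsq _ h1f
  have hb2 := hsq _ h2f
  have hc2 := hsq _ h3f
  have hx2 := hsq _ h1v
  have hy2 := hsq _ h2v
  have hz2 := hsq _ h3v
  have key : ∀ σ : ℝ, σ ^ 2 = 1 →
      inner ℝ (v - (σ • f + ((x - σ * a) / 2) • e₁ + ((y - σ * b) / 2) • e₂ +
        ((z - σ * c) / 2) • e₃)) (v - (σ • f + ((x - σ * a) / 2) • e₁ + ((y - σ * b) / 2) • e₂ +
        ((z - σ * c) / 2) • e₃)) = 1 - 2 * σ * t + σ * (a * x + b * y + c * z) := by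
    intro σ hσ
    simp only [inner_sub_left, inner_sub_right, inner_add_left, inner_add_right, inner_smul_left,
      inner_smul_right, RCLike.conj_to_real, real_inner_comm e₁ e₂, real_inner_comm e₁ e₃,
      real_inner_comm e₂ e₃, real_inner_comm e₁ v, real_inner_comm e₂ v, real_inner_comm e₃ v,
      real_inner_comm e₁ f, real_inner_comm e₂ f, real_inner_comm e₃ f, real_inner_comm v f, h11,
      h22, h33, hff, hvv, h12, h13, h23, ← ha, ← hb, ← hc, ← ht, ← hx, ← hy, ← hz]
    linear_combination (-1 / 2) * (hx2 + hy2 + hz2) + (2 - a ^ 2 / 2 - b ^ 2 / 2 - c ^ 2 / 2) * hσ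
      - (ha2 + hb2 + hc2) / 2
  have hpos := inner_self_nonneg (𝕜 := ℝ) (x := v - ((1 : ℝ) • f + ((x - 1 * a) / 2) • e₁ +
    ((y - 1 * b) / 2) • e₂ + ((z - 1 * c) / 2) • e₃))
  have hneg := inner_self_nonneg (𝕜 := ℝ) (x := v - ((-1 : ℝ) • f + ((x - -1 * a) / 2) • e₁ +
    ((y - -1 * b) / 2) • e₂ + ((z - -1 * c) / 2) • e₃))
  rw [RCLike.re_to_real, key _ (by norm_num)] at hpos hneg
  -- The quantity in `key` is the squared distance between the remainder of `v` and `σ` times that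
  -- of `f`; it is nonnegative for both signs, and integrality makes it vanish for one.
  have hz : ∃ σ : ℝ, σ ^ 2 = 1 ∧ 1 - 2 * σ * t + σ * (a * x + b * y + c * z) = 0 := by
    have h1 := hmul a x h1f h1v
    have h2 := hmul b y h2f h2v
    have h3 := hmul c z h3f h3v
    generalize a * x = A at *
    generalize b * y = B at *
    generalize c * z = C at *
    generalize t = T at *
    rcases h1 with rfl | rfl <;> rcases h2 with rfl | rfl <;> rcases h3 with rfl | rfl <;>
      rcases hvf with rfl | rfl | rfl <;>
      first
      | (refine ⟨1, one_pow 2, ?_⟩; linarith)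
      | (refine ⟨-1, by norm_num, ?_⟩; linarith)
  obtain ⟨σ, hσ, hσ0⟩ := hz
  have := key σ hσ
  rw [hσ0, inner_self_eq_zero, sub_eq_zero] at this
  rw [this]
  refine add_mem (add_mem (add_mem ?_ ?_) ?_) ?_ <;>
    exact Submodule.smul_mem _ _ (Submodule.subset_span (by simp))

/-- The projections of `f₁` and `σ f₂` on the plane of `e₁, e₂` coincide and have norm 1, as do the
remainders. Orthogonality of `f₁` and `f₂` then makes the remainders opposite. -/
lemma mem_span_of_parallel {e₁ e₂ f₁ f₂ : F}
    (h11 : inner ℝ e₁ e₁ = (2 : ℝ)) (h22 : inner ℝ e₂ e₂ = (2 : ℝ))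
    (g11 : inner ℝ f₁ f₁ = (2 : ℝ)) (g22 : inner ℝ f₂ f₂ = (2 : ℝ))
    (h12 : inner ℝ e₁ e₂ = (0 : ℝ)) (g12 : inner ℝ f₁ f₂ = (0 : ℝ))
    {a b σ : ℝ} (ha : a ^ 2 = 1) (hb : b ^ 2 = 1) (hσ : σ ^ 2 = 1)
    (k11 : inner ℝ e₁ f₁ = a) (k21 : inner ℝ e₂ f₁ = b)
    (k12 : inner ℝ e₁ f₂ = σ * a) (k22 : inner ℝ e₂ f₂ = σ * b) :
    f₂ ∈ Submodule.span ℝ ({e₁, e₂, f₁} : Set F) := by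
  have key : f₂ - (σ • (a • e₁ + b • e₂ - f₁)) = 0 := by
    rw [← inner_self_eq_zero (𝕜 := ℝ)]
    simp only [inner_sub_left, inner_sub_right, inner_add_left, inner_add_right, inner_smul_left,
      inner_smul_right, RCLike.conj_to_real, real_inner_comm e₁ e₂, real_inner_comm e₁ f₁,
      real_inner_comm e₁ f₂, real_inner_comm e₂ f₁, real_inner_comm e₂ f₂, real_inner_comm f₁ f₂,
      h11, h22, g11, g22, h12, g12, k11, k12, k21, k22]
    linear_combination (-2 * σ ^ 2) * (ha + hb) + (2 * σ ^ 2) * (ha + hb)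
      + (-2) * hσ - 2 * σ ^ 2 * (ha + hb)
  rw [sub_eq_zero] at key
  rw [key]
  refine Submodule.smul_mem _ _ (sub_mem (add_mem ?_ ?_) ?_)
  · exact Submodule.smul_mem _ _ (Submodule.subset_span (by simp))
  · exact Submodule.smul_mem _ _ (Submodule.subset_span (by simp))
  · exact Submodule.subset_span (by simp)

/-- The projections of `f₁` and `f₂` on the plane of `e₁, e₂` are orthogonal, and that of `v` is
orthogonal to one of them. For that `fᵢ` the unit remainders of `v` and `fᵢ` have inner product
`±1`, so they agree up to sign. -/
lemma mem_span_of_antiparallel {e₁ e₂ f₁ f₂ v : F}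
    (h11 : inner ℝ e₁ e₁ = (2 : ℝ)) (h22 : inner ℝ e₂ e₂ = (2 : ℝ))
    (g11 : inner ℝ f₁ f₁ = (2 : ℝ)) (g22 : inner ℝ f₂ f₂ = (2 : ℝ))
    (h12 : inner ℝ e₁ e₂ = (0 : ℝ))
    {a b σ x y z w : ℝ} (ha : a ^ 2 = 1) (hb : b ^ 2 = 1) (hσ : σ ^ 2 = 1)
    (hx : x ^ 2 = 1) (hy : y ^ 2 = 1) (hz : z ^ 2 = 1) (hw : w ^ 2 = 1)
    (k11 : inner ℝ e₁ f₁ = a) (k21 : inner ℝ e₂ f₁ = b)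
    (k12 : inner ℝ e₁ f₂ = σ * a) (k22 : inner ℝ e₂ f₂ = - (σ * b))
    (hvv : inner ℝ v v = (2 : ℝ)) (k1v : inner ℝ e₁ v = x) (k2v : inner ℝ e₂ v = y)
    (l1v : inner ℝ f₁ v = z) (l2v : inner ℝ f₂ v = w) :
    v ∈ Submodule.span ℝ ({e₁, e₂, f₁, f₂} : Set F) := by
  have h1 : ∀ {x y : F}, x - y = 0 → x = y := fun h => sub_eq_zero.1 h
  have hs : (a * x + b * y = 0) ∨ (a * x - b * y = 0) := by
    rw [← mul_eq_zero]
    linear_combination x ^ 2 * ha - y ^ 2 * hb + hx - hy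
  rcases hs with hs | hs
  · have key : v - ((x / 2) • e₁ + (y / 2) • e₂ +
        z • (f₁ - (a / 2) • e₁ - (b / 2) • e₂)) = 0 := by
      rw [← inner_self_eq_zero (𝕜 := ℝ)]
      simp only [inner_sub_left, inner_sub_right, inner_add_left, inner_add_right,
        inner_smul_left, inner_smul_right, RCLike.conj_to_real, real_inner_comm e₁ e₂,
        real_inner_comm e₁ f₁, real_inner_comm e₂ f₁, real_inner_comm e₁ v, real_inner_comm e₂ v,
        real_inner_comm f₁ v, h11, h22, g11, h12, k11, k21, hvv, k1v, k2v, l1v]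
      linear_combination z * hs - hz - (hx + hy) / 2 + z ^ 2 * (-(ha + hb) / 2)
    rw [h1 key]
    refine add_mem (add_mem ?_ ?_) (Submodule.smul_mem _ _ (sub_mem (sub_mem ?_ ?_) ?_)) <;>
    first
    | exact Submodule.smul_mem _ _ (Submodule.subset_span (by simp))
    | exact Submodule.subset_span (by simp)
  · have key : v - ((x / 2) • e₁ + (y / 2) • e₂ +
        w • (f₂ - (σ * a / 2) • e₁ + (σ * b / 2) • e₂)) = 0 := by
      rw [← inner_self_eq_zero (𝕜 := ℝ)]
      simp only [inner_sub_left, inner_sub_right, inner_add_left, inner_add_right,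
        inner_smul_left, inner_smul_right, RCLike.conj_to_real, real_inner_comm e₁ e₂,
        real_inner_comm e₁ f₂, real_inner_comm e₂ f₂, real_inner_comm e₁ v, real_inner_comm e₂ v,
        real_inner_comm f₂ v, h11, h22, g22, h12, k12, k22, hvv, k1v, k2v, l2v]
      linear_combination σ * w * hs - hw - (hx + hy) / 2 + w ^ 2 * σ ^ 2 * (-(ha + hb) / 2)
        - w ^ 2 * hσ
    rw [h1 key]
    refine add_mem (add_mem ?_ ?_) (Submodule.smul_mem _ _ (add_mem (sub_mem ?_ ?_) ?_)) <;>
    first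
    | exact Submodule.smul_mem _ _ (Submodule.subset_span (by simp))
    | exact Submodule.subset_span (by simp)

lemma sq_eq_one_of_eq_one_or {x : ℝ} (h : x = 1 ∨ x = -1) : x ^ 2 = 1 := by
  rcases h with h | h <;> rw [h] <;> norm_num

/-- The sign patterns of `f₁` and `f₂` on the pair `e₁, e₂` are proportional or orthogonal; either
way dimensions are lost, which settles the case of three classes of two vectors. -/
lemma mem_span_or_forall_mem_span {e₁ e₂ f₁ f₂ : F}
    (h11 : inner ℝ e₁ e₁ = (2 : ℝ)) (h22 : inner ℝ e₂ e₂ = (2 : ℝ))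
    (g11 : inner ℝ f₁ f₁ = (2 : ℝ)) (g22 : inner ℝ f₂ f₂ = (2 : ℝ))
    (h12 : inner ℝ e₁ e₂ = (0 : ℝ)) (g12 : inner ℝ f₁ f₂ = (0 : ℝ))
    (k11 : inner ℝ e₁ f₁ = (1 : ℝ) ∨ inner ℝ e₁ f₁ = (-1 : ℝ))
    (k12 : inner ℝ e₁ f₂ = (1 : ℝ) ∨ inner ℝ e₁ f₂ = (-1 : ℝ))
    (k21 : inner ℝ e₂ f₁ = (1 : ℝ) ∨ inner ℝ e₂ f₁ = (-1 : ℝ))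
    (k22 : inner ℝ e₂ f₂ = (1 : ℝ) ∨ inner ℝ e₂ f₂ = (-1 : ℝ)) :
    f₂ ∈ Submodule.span ℝ ({e₁, e₂, f₁} : Set F) ∨
      ∀ v : F, inner ℝ v v = (2 : ℝ) →
        (inner ℝ e₁ v = (1 : ℝ) ∨ inner ℝ e₁ v = (-1 : ℝ)) →
        (inner ℝ e₂ v = (1 : ℝ) ∨ inner ℝ e₂ v = (-1 : ℝ)) →
        (inner ℝ f₁ v = (1 : ℝ) ∨ inner ℝ f₁ v = (-1 : ℝ)) →
        (inner ℝ f₂ v = (1 : ℝ) ∨ inner ℝ f₂ v = (-1 : ℝ)) →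
        v ∈ Submodule.span ℝ ({e₁, e₂, f₁, f₂} : Set F) := by
  have s11 := sq_eq_one_of_eq_one_or k11
  have s12 := sq_eq_one_of_eq_one_or k12
  have s21 := sq_eq_one_of_eq_one_or k21
  have s22 := sq_eq_one_of_eq_one_or k22
  set σ : ℝ := inner ℝ e₁ f₂ * inner ℝ e₁ f₁ with hσ
  have hσ2 : σ ^ 2 = 1 := by rw [hσ, mul_pow, s11, s12, one_mul]
  have hσa : inner ℝ e₁ f₂ = σ * inner ℝ e₁ f₁ := by
    rw [hσ, mul_assoc, ← sq, s11, mul_one]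
  have hq : inner ℝ e₂ f₂ = σ * inner ℝ e₂ f₁ ∨ inner ℝ e₂ f₂ = -(σ * inner ℝ e₂ f₁) := by
    rw [← sq_eq_sq_iff_eq_or_eq_neg, s22, mul_pow, hσ2, s21, one_mul]
  rcases hq with hq | hq
  · exact Or.inl (mem_span_of_parallel h11 h22 g11 g22 h12 g12 s11 s21 hσ2 rfl rfl hσa hq)
  · exact Or.inr fun v hv h1 h2 h3 h4 => mem_span_of_antiparallel h11 h22 g11 g22 h12 s11 s21
      hσ2 (sq_eq_one_of_eq_one_or h1) (sq_eq_one_of_eq_one_or h2) (sq_eq_one_of_eq_one_or h3)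
      (sq_eq_one_of_eq_one_or h4) rfl rfl hσa hq hv rfl rfl rfl rfl

lemma finrank_span_range_le_four {ι : Type*} {e : ι → F} {a b c d : F}
    (h : ∀ i, e i ∈ Submodule.span ℝ ({a, b, c, d} : Set F)) :
    Module.finrank ℝ (Submodule.span ℝ (Set.range e)) ≤ 4 := by
  classical
  have hfin : FiniteDimensional ℝ (Submodule.span ℝ ({a, b, c, d} : Set F)) :=
    FiniteDimensional.span_of_finite ℝ (Set.toFinite _)
  have hle : Submodule.span ℝ (Set.range e) ≤ Submodule.span ℝ ({a, b, c, d} : Set F) :=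
    Submodule.span_le.2 (by rintro _ ⟨i, rfl⟩; exact h i)
  refine (Submodule.finrank_mono hle).trans ?_
  have := finrank_span_finset_le_card (R := ℝ) ({a, b, c, d} : Finset F)
  have hs : (({a, b, c, d} : Finset F) : Set F) = {a, b, c, d} := by push_cast; rfl
  rw [Set.finrank, hs] at this
  exact this.trans Finset.card_le_four

/-- Vectors of norm `√2` in three classes, orthogonal within each class and with inner products
`±1` across the classes: if there are at least six of them and they span at least five dimensions,
then only one class occurs. -/
theorem class_const_of_five_le_finrank {ι : Type*} [Fintype ι] {e : ι → F} {c : ι → Fin 3}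
    (h2 : ∀ i, inner ℝ (e i) (e i) = (2 : ℝ))
    (h0 : ∀ i j, i ≠ j → c i = c j → inner ℝ (e i) (e j) = (0 : ℝ))
    (h1 : ∀ i j, c i ≠ c j → inner ℝ (e i) (e j) = (1 : ℝ) ∨ inner ℝ (e i) (e j) = (-1 : ℝ))
    (hcard : 6 ≤ Fintype.card ι)
    (hrank : 5 ≤ Module.finrank ℝ (Submodule.span ℝ (Set.range e))) (i j : ι) : c i = c j := by
  classical
  -- Three members of one class and one vector of another would already span the whole family, in
  -- dimension at most 4.
  have hsmall : ∀ x : Fin 3, ∀ f : ι, c f ≠ x →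
      (Finset.univ.filter fun i => c i = x).card ≤ 2 := by
    intro x f hf
    by_contra hlt
    obtain ⟨a, b, d, ha, hb, hd, hab, had, hbd⟩ := Finset.two_lt_card_iff.1 (not_le.1 hlt)
    rw [Finset.mem_filter] at ha hb hd
    have haf : c a ≠ c f := fun h => hf (by rw [← h, ha.2])
    have hbf : c b ≠ c f := fun h => hf (by rw [← h, hb.2])
    have hdf : c d ≠ c f := fun h => hf (by rw [← h, hd.2])
    have := finrank_span_range_le_four (e := e) (a := e a) (b := e b) (c := e d) (d := e f) ?_
    · omega
    intro v
    by_cases hva : v = a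
    · exact Submodule.subset_span (by simp [hva])
    by_cases hvb : v = b
    · exact Submodule.subset_span (by simp [hvb])
    by_cases hvd : v = d
    · exact Submodule.subset_span (by simp [hvd])
    by_cases hvf : v = f
    · exact Submodule.subset_span (by simp [hvf])
    have hab0 := h0 a b hab (ha.2.trans hb.2.symm)
    have had0 := h0 a d had (ha.2.trans hd.2.symm)
    have hbd0 := h0 b d hbd (hb.2.trans hd.2.symm)
    by_cases hvx : c v = x
    · exact mem_span_of_orthogonal_frame (h2 a) (h2 b) (h2 d) (h2 f) (h2 v) hab0 had0 hbd0
        (h0 a v (Ne.symm hva) (ha.2.trans hvx.symm)) (h0 b v (Ne.symm hvb) (hb.2.trans hvx.symm))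
        (h0 d v (Ne.symm hvd) (hd.2.trans hvx.symm)) (h1 _ _ haf) (h1 _ _ hbf) (h1 _ _ hdf)
        (h1 _ _ fun h => hf (by rw [← h, hvx]))
    · refine mem_span_of_transversal (h2 a) (h2 b) (h2 d) (h2 f) (h2 v) hab0 had0 hbd0
        (h1 _ _ fun h => hvx (by rw [← h, ha.2])) (h1 _ _ fun h => hvx (by rw [← h, hb.2]))
        (h1 _ _ fun h => hvx (by rw [← h, hd.2])) (h1 _ _ haf) (h1 _ _ hbf) (h1 _ _ hdf) ?_
      by_cases hcv : c v = c f
      · exact Or.inl (h0 v f hvf hcv)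
      · exact Or.inr (h1 v f hcv)
  by_contra hij
  have hle : ∀ x : Fin 3, (Finset.univ.filter fun i => c i = x).card ≤ 2 := by
    intro x
    by_cases hx : c i = x
    · exact hsmall x j fun h => hij (hx.trans h.symm)
    · exact hsmall x i hx
  have hsum : Fintype.card ι = ∑ x : Fin 3, (Finset.univ.filter fun i => c i = x).card :=
    Finset.card_eq_sum_card_fiberwise (f := c) (t := Finset.univ) (by simp [Set.MapsTo])
  rw [Fin.sum_univ_three] at hsum
  have l0 := hle 0
  have l1 := hle 1
  have l2 := hle 2
  obtain ⟨a, a', haa, ha⟩ := Finset.card_eq_two.1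
    (show (Finset.univ.filter fun i => c i = 0).card = 2 by omega)
  obtain ⟨b, b', hbb, hb⟩ := Finset.card_eq_two.1
    (show (Finset.univ.filter fun i => c i = 1).card = 2 by omega)
  obtain ⟨d, d', hdd, hd⟩ := Finset.card_eq_two.1
    (show (Finset.univ.filter fun i => c i = 2).card = 2 by omega)
  have hca : ∀ v, c v = 0 ↔ v = a ∨ v = a' := fun v => by simpa using Finset.ext_iff.1 ha v
  have hcb : ∀ v, c v = 1 ↔ v = b ∨ v = b' := fun v => by simpa using Finset.ext_iff.1 hb v
  have hcd : ∀ v, c v = 2 ↔ v = d ∨ v = d' := fun v => by simpa using Finset.ext_iff.1 hd v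
  have ca := (hca a).2 (Or.inl rfl)
  have ca' := (hca a').2 (Or.inr rfl)
  have cb := (hcb b).2 (Or.inl rfl)
  have cb' := (hcb b').2 (Or.inr rfl)
  have cd := (hcd d).2 (Or.inl rfl)
  have cd' := (hcd d').2 (Or.inr rfl)
  have hall : ∀ v, v = a ∨ v = a' ∨ v = b ∨ v = b' ∨ v = d ∨ v = d' := by
    intro v
    have : c v = 0 ∨ c v = 1 ∨ c v = 2 := by
      generalize c v = x
      fin_cases x <;> simp
    rw [hca, hcb, hcd] at this
    tauto
  have key : ∀ {x y z w : F}, e a ∈ Submodule.span ℝ ({x, y, z, w} : Set F) →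
      e a' ∈ Submodule.span ℝ ({x, y, z, w} : Set F) →
      e b ∈ Submodule.span ℝ ({x, y, z, w} : Set F) →
      e b' ∈ Submodule.span ℝ ({x, y, z, w} : Set F) →
      e d ∈ Submodule.span ℝ ({x, y, z, w} : Set F) →
      e d' ∈ Submodule.span ℝ ({x, y, z, w} : Set F) → False := by
    intro x y z w m1 m2 m3 m4 m5 m6
    have := finrank_span_range_le_four (e := e) (a := x) (b := y) (c := z) (d := w) (fun v => by
      rcases hall v with h | h | h | h | h | h <;> rw [h] <;> assumption)
    omega
  have h1' : ∀ i j, ∀ x y : Fin 3, c i = x → c j = y → x ≠ y →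
      (inner ℝ (e i) (e j) = (1 : ℝ) ∨ inner ℝ (e i) (e j) = (-1 : ℝ)) :=
    fun i j x y hx hy hxy => h1 i j (by rw [hx, hy]; exact hxy)
  have h0' : ∀ i j, ∀ x : Fin 3, c i = x → c j = x → i ≠ j → inner ℝ (e i) (e j) = (0 : ℝ) :=
    fun i j x hx hy hij => h0 i j hij (hx.trans hy.symm)
  -- Only the distribution `2 + 2 + 2` remains. Each outcome of comparing pairs confines all six
  -- vectors to the span of four.
  rcases mem_span_or_forall_mem_span (h2 a) (h2 a') (h2 b) (h2 b') (h0' _ _ _ ca ca' haa)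
    (h0' _ _ _ cb cb' hbb) (h1' _ _ _ _ ca cb (by decide)) (h1' _ _ _ _ ca cb' (by decide))
    (h1' _ _ _ _ ca' cb (by decide)) (h1' _ _ _ _ ca' cb' (by decide)) with hb' | hall'
  · rcases mem_span_or_forall_mem_span (h2 a) (h2 a') (h2 d) (h2 d') (h0' _ _ _ ca ca' haa)
      (h0' _ _ _ cd cd' hdd) (h1' _ _ _ _ ca cd (by decide)) (h1' _ _ _ _ ca cd' (by decide))
      (h1' _ _ _ _ ca' cd (by decide)) (h1' _ _ _ _ ca' cd' (by decide)) with hd' | hall'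
    · refine key (x := e a) (y := e a') (z := e b) (w := e d)
        (Submodule.subset_span (by simp)) (Submodule.subset_span (by simp))
        (Submodule.subset_span (by simp)) (Submodule.span_mono ?_ hb')
        (Submodule.subset_span (by simp)) (Submodule.span_mono ?_ hd')
      · intro x; simp; tauto
      · intro x; simp; tauto
    · exact key (x := e a) (y := e a') (z := e d) (w := e d')
        (Submodule.subset_span (by simp)) (Submodule.subset_span (by simp))
        (hall' _ (h2 b) (h1' _ _ _ _ ca cb (by decide)) (h1' _ _ _ _ ca' cb (by decide))
          (h1' _ _ _ _ cd cb (by decide)) (h1' _ _ _ _ cd' cb (by decide)))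
        (hall' _ (h2 b') (h1' _ _ _ _ ca cb' (by decide)) (h1' _ _ _ _ ca' cb' (by decide))
          (h1' _ _ _ _ cd cb' (by decide)) (h1' _ _ _ _ cd' cb' (by decide)))
        (Submodule.subset_span (by simp)) (Submodule.subset_span (by simp))
  · exact key (x := e a) (y := e a') (z := e b) (w := e b')
      (Submodule.subset_span (by simp)) (Submodule.subset_span (by simp))
      (Submodule.subset_span (by simp)) (Submodule.subset_span (by simp))
      (hall' _ (h2 d) (h1' _ _ _ _ ca cd (by decide)) (h1' _ _ _ _ ca' cd (by decide))
        (h1' _ _ _ _ cb cd (by decide)) (h1' _ _ _ _ cb' cd (by decide)))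
      (hall' _ (h2 d') (h1' _ _ _ _ ca cd' (by decide)) (h1' _ _ _ _ ca' cd' (by decide))
        (h1' _ _ _ _ cb cd' (by decide)) (h1' _ _ _ _ cb' cd' (by decide)))

/-- The same family with opposite vectors allowed within a class has at most twice as many members
as it has dimensions, once it spans at least five dimensions. -/
theorem card_le_two_mul_finrank_span {ι : Type*} [Fintype ι] {e : ι → F} {c : ι → Fin 3}
    (h2 : ∀ i, inner ℝ (e i) (e i) = (2 : ℝ))
    (h0 : ∀ i j, i ≠ j → c i = c j →
      inner ℝ (e i) (e j) = (0 : ℝ) ∨ inner ℝ (e i) (e j) = (-2 : ℝ))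
    (h1 : ∀ i j, c i ≠ c j → inner ℝ (e i) (e j) = (1 : ℝ) ∨ inner ℝ (e i) (e j) = (-1 : ℝ))
    (hrank : 5 ≤ Module.finrank ℝ (Submodule.span ℝ (Set.range e))) :
    Fintype.card ι ≤ 2 * Module.finrank ℝ (Submodule.span ℝ (Set.range e)) := by
  classical
  have hinj : Function.Injective e := by
    intro i j hij
    by_contra hne
    have h := h2 i
    nth_rewrite 2 [hij] at h
    by_cases hc : c i = c j
    · rcases h0 i j hne hc with h' | h' <;> rw [h'] at h <;> norm_num at h
    · rcases h1 i j hc with h' | h' <;> rw [h'] at h <;> norm_num at h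
  have hopp : ∀ i j, inner ℝ (e i) (e j) = (-2 : ℝ) → e j = - e i := by
    intro i j h
    have : e j + e i = 0 := by
      rw [← inner_self_eq_zero (𝕜 := ℝ)]
      simp only [inner_add_left, inner_add_right, h2, h, real_inner_comm (e i) (e j)]
      norm_num
    exact eq_neg_of_add_eq_zero_left this
  -- A maximal subfamily without opposite pairs keeps the span and at least half of the members.
  obtain ⟨J, hJ, hmax⟩ := (Finset.univ.filter fun J : Finset ι =>
    ∀ i ∈ J, ∀ j ∈ J, e j ≠ - e i).exists_maximal ⟨∅, by simp⟩
  rw [Finset.mem_filter] at hJ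
  have hne0 : ∀ i, e i ≠ - e i := by
    intro i h
    have h' := h2 i
    nth_rewrite 1 [h] at h'
    rw [inner_neg_left, h2] at h'
    norm_num at h'
  have hcover : ∀ i, i ∉ J → ∃ j ∈ J, e j = - e i := by
    intro i hi
    by_contra hcon
    push Not at hcon
    have hins : insert i J ∈ Finset.univ.filter fun J : Finset ι =>
        ∀ i ∈ J, ∀ j ∈ J, e j ≠ - e i := by
      rw [Finset.mem_filter]
      refine ⟨Finset.mem_univ _, ?_⟩
      intro x hx y hy
      rcases Finset.mem_insert.1 hx with hxi | hxJ <;> rcases Finset.mem_insert.1 hy with hyi | hyJ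
      · rw [hxi, hyi]
        exact hne0 i
      · rw [hxi]
        exact hcon y hyJ
      · rw [hyi]
        intro h
        exact hcon x hxJ (by rw [h, neg_neg])
      · exact hJ.2 x hxJ y hyJ
    exact hi (hmax hins (Finset.subset_insert _ _) (Finset.mem_insert_self _ _))
  have hspan : Submodule.span ℝ (Set.range e) =
      Submodule.span ℝ (Set.range fun i : J => e i) := by
    apply le_antisymm
    · rw [Submodule.span_le]
      rintro _ ⟨i, rfl⟩
      by_cases hi : i ∈ J
      · exact Submodule.subset_span ⟨⟨i, hi⟩, rfl⟩
      · obtain ⟨j, hj, hij⟩ := hcover i hi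
        rw [SetLike.mem_coe, ← neg_mem_iff, ← hij]
        exact Submodule.subset_span ⟨⟨j, hj⟩, rfl⟩
    · apply Submodule.span_mono
      rintro _ ⟨i, rfl⟩
      exact ⟨i, rfl⟩
  have hJcompl : Jᶜ.card ≤ J.card := by
    have : ∀ i : ι, ∃ j, i ∈ Jᶜ → j ∈ J ∧ e j = - e i := by
      intro i
      by_cases hi : i ∈ J
      · exact ⟨i, fun h => absurd hi (Finset.mem_compl.1 h)⟩
      · obtain ⟨j, hj⟩ := hcover i hi
        exact ⟨j, fun _ => hj⟩
    choose g hg using this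
    refine Finset.card_le_card_of_injOn g (fun i hi => (hg i hi).1) ?_
    intro x hx y hy hxy
    have hx' := (hg x hx).2
    have hy' := (hg y hy).2
    rw [hxy, hy', neg_inj] at hx'
    exact hinj hx'.symm
  have htot : Fintype.card ι = J.card + Jᶜ.card := by
    rw [Finset.card_compl]
    have := J.card_le_univ
    omega
  have hJcard : Fintype.card J = J.card := Fintype.card_coe J
  rw [hspan] at hrank ⊢
  have g0 : ∀ i j : J, i ≠ j → c i = c j → inner ℝ (e i) (e j) = (0 : ℝ) := by
    intro i j hij hc
    rcases h0 i j (fun h => hij (Subtype.ext h)) hc with h | h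
    · exact h
    · exact absurd (hopp _ _ h) (hJ.2 i i.2 j j.2)
  -- With six members there is a single class, so `J` is orthogonal and its size is the rank; with
  -- at most five, the rank hypothesis suffices.
  by_cases h6 : 6 ≤ J.card
  · have hconst := class_const_of_five_le_finrank (e := fun i : J => e i) (c := fun i : J => c i)
      (fun i => h2 i) g0 (fun i j => h1 i j) (hJcard.symm ▸ h6) hrank
    have hli : LinearIndependent ℝ fun i : J => e i :=
      linearIndependent_of_ne_zero_of_inner_eq_zero
        (fun i h => by have := h2 i; rw [h] at this; simp at this)
        (fun i j hij => g0 i j hij (hconst i j))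
    rw [finrank_span_eq_card hli]
    omega
  · omega

end RootVectors

/-! ### Angle `arccos (1/3)`: projection along a regular tetrahedron. -/

section Tetrahedron

variable {F : Type*} [NormedAddCommGroup F] [InnerProductSpace ℝ F]

/-- Two signs are positive and two negative, so up to a global sign the pattern is one of the three
splittings of four indices into pairs, named by the partner of `0`. -/
lemma exists_split_of_sum_eq_zero {s : Fin 4 → ℝ} (hs : ∀ i, s i = 1 / 3 ∨ s i = -(1 / 3))
    (h0 : s 0 + s 1 + s 2 + s 3 = 0) :
    ∃ (j : Fin 3) (a : ℝ), a ^ 2 = 1 ∧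
      ∀ i, s i = a * (if i = 0 ∨ i = j.succ then 1 / 3 else -(1 / 3)) := by
  have hneg : ∀ i k, s i = s k ∨ s i = - s k := by
    intro i k
    rcases hs i with h | h <;> rcases hs k with h' | h' <;> rw [h, h'] <;> norm_num
  have hne : s 0 ≠ 0 := by rcases hs 0 with h | h <;> rw [h] <;> norm_num
  have ha : (3 * s 0) ^ 2 = 1 := by rcases hs 0 with h | h <;> rw [h] <;> norm_num
  have hfin : ∀ j : Fin 3, (∀ i, s i = (if i = 0 ∨ i = j.succ then s 0 else - s 0)) →
      ∃ (j : Fin 3) (a : ℝ), a ^ 2 = 1 ∧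
        ∀ i, s i = a * (if i = 0 ∨ i = j.succ then 1 / 3 else -(1 / 3)) := by
    intro j hj
    refine ⟨j, 3 * s 0, ha, fun i => ?_⟩
    rw [hj i]
    split_ifs <;> simp <;> ring
  rcases hneg 1 0 with h1 | h1 <;> rcases hneg 2 0 with h2 | h2 <;> rcases hneg 3 0 with h3 | h3
  all_goals first
    | exact absurd (by linarith) hne
    | (refine hfin 0 fun i => ?_; fin_cases i <;> simp [h1, h2, h3]; done)
    | (refine hfin 1 fun i => ?_; fin_cases i <;> simp [h1, h2, h3]; done)
    | (refine hfin 2 fun i => ?_; fin_cases i <;> simp [h1, h2, h3]; done)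

/-- Let unit vectors with mutual inner products `±1/3` span `r ≥ 8` dimensions. If their span
contains the vertices of a regular tetrahedron each of which has inner product `±1/3` with every
vector other than the vertices and their opposites, then there are at most `2 (r - 1)` vectors. -/
theorem card_le_of_tetrahedron [FiniteDimensional ℝ F] {X : Finset F}
    (hunit : ∀ x ∈ X, inner ℝ x x = (1 : ℝ))
    (hX : ∀ x ∈ X, ∀ y ∈ X, x ≠ y → inner ℝ x y = (1 / 3 : ℝ) ∨ inner ℝ x y = (-(1 / 3) : ℝ))
    {p : Fin 4 → F} (hp : ∀ i k, inner ℝ (p i) (p k) = if i = k then (1 : ℝ) else -(1 / 3))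
    (hsum : p 0 + p 1 + p 2 + p 3 = 0)
    (hspan : ∀ i, p i ∈ Submodule.span ℝ (X : Set F))
    (hXp : ∀ x ∈ X, (∃ i, x = p i ∨ x = - p i) ∨
      ∀ i, inner ℝ (p i) x = (1 / 3 : ℝ) ∨ inner ℝ (p i) x = (-(1 / 3) : ℝ))
    (hrank : 8 ≤ Module.finrank ℝ (Submodule.span ℝ (X : Set F))) :
    X.card ≤ 2 * Module.finrank ℝ (Submodule.span ℝ (X : Set F)) - 2 := by
  classical
  set Y := X.filter fun x => ∀ i, inner ℝ (p i) x = (1 / 3 : ℝ) ∨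
    inner ℝ (p i) x = (-(1 / 3) : ℝ) with hY
  -- `X` cannot contain two opposite vectors, so each vertex accounts for at most one element.
  have hcompl : (X.filter fun x => ¬ ∀ i, inner ℝ (p i) x = (1 / 3 : ℝ) ∨
      inner ℝ (p i) x = (-(1 / 3) : ℝ)).card ≤ 4 := by
    have hsub : (X.filter fun x => ¬ ∀ i, inner ℝ (p i) x = (1 / 3 : ℝ) ∨
        inner ℝ (p i) x = (-(1 / 3) : ℝ)) ⊆
        Finset.univ.biUnion fun i : Fin 4 => X.filter fun x => x = p i ∨ x = - p i := by
      intro x hx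
      rw [Finset.mem_filter] at hx
      obtain ⟨i, hi⟩ := (hXp x hx.1).resolve_right hx.2
      rw [Finset.mem_biUnion]
      exact ⟨i, Finset.mem_univ _, Finset.mem_filter.2 ⟨hx.1, hi⟩⟩
    refine (Finset.card_le_card hsub).trans (Finset.card_biUnion_le.trans ?_)
    refine (Finset.sum_le_card_nsmul Finset.univ _ 1 fun i _ => ?_).trans (by simp)
    rw [Finset.card_le_one]
    intro x hx y hy
    rw [Finset.mem_filter] at hx hy
    by_contra hxy
    have hxx := hunit x hx.1
    have hop : y = - x := by
      rcases hx.2 with h | h <;> rcases hy.2 with h' | h' <;> rw [h, h'] <;> simp_all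
    have := hX x hx.1 y hy.1 hxy
    rw [hop, inner_neg_right, hxx] at this
    rcases this with h | h <;> norm_num at h
  have hsplit : ∀ y : Y, ∃ (j : Fin 3) (a : ℝ), a ^ 2 = 1 ∧
      ∀ i, inner ℝ (p i) (y : F) = a * (if i = 0 ∨ i = j.succ then 1 / 3 else -(1 / 3)) := by
    intro y
    refine exists_split_of_sum_eq_zero (Finset.mem_filter.1 y.2).2 ?_
    rw [← inner_add_left, ← inner_add_left, ← inner_add_left, hsum, inner_zero_left]
  choose c a ha hca using hsplit
  set h : Fin 3 → F := fun j => p 0 + p j.succ with hh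
  have hhp : ∀ j i, inner ℝ (p i) (h j) = if i = 0 ∨ i = j.succ then (2 / 3 : ℝ) else -(2 / 3) := by
    intro j i
    simp only [hh, inner_add_right, hp]
    fin_cases j <;> fin_cases i <;> simp <;> norm_num
  have hhh : ∀ j k, inner ℝ (h j) (h k) = if j = k then (4 / 3 : ℝ) else 0 := by
    intro j k
    rw [show h j = p 0 + p j.succ from rfl, inner_add_left, hhp, hhp]
    fin_cases j <;> fin_cases k <;> simp <;> norm_num
  set s3 : ℝ := Real.sqrt 3 with hs3
  have hs3sq : s3 * s3 = 3 := Real.mul_self_sqrt (by norm_num)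
  -- `h (c y) / 2`, of squared norm `1/3`, is the projection of `a y • y` on the tetrahedron's span;
  -- the factor `√3` turns the remaining `2/3` into 2.
  set e : Y → F := fun y => s3 • (a y • (y : F) - (1 / 2 : ℝ) • h (c y)) with he
  have hhy : ∀ j, ∀ y : Y, inner ℝ (h j) (y : F) = if j = c y then a y * (2 / 3) else 0 := by
    intro j y
    rw [show h j = p 0 + p j.succ from rfl, inner_add_left, hca, hca]
    generalize c y = k
    generalize a y = b
    fin_cases j <;> fin_cases k <;> simp <;> ring
  have hhe : ∀ j, ∀ y : Y, inner ℝ (h j) (e y) = (0 : ℝ) := by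
    intro j y
    simp only [he, inner_smul_right, inner_sub_right, hhy, hhh]
    split_ifs
    · linear_combination s3 * (2 / 3) * ha y
    · ring
  have hee : ∀ x y : Y, inner ℝ (e x) (e y) =
      3 * (a x * a y * inner ℝ (x : F) (y : F)) - if c x = c y then (1 : ℝ) else 0 := by
    intro x y
    have : inner ℝ (e x) (e y) = s3 * (a x * inner ℝ (x : F) (e y)) := by
      rw [show e x = s3 • (a x • (x : F) - (1 / 2 : ℝ) • h (c x)) from rfl, inner_smul_left,
        inner_sub_left, inner_smul_left, inner_smul_left, hhe]
      simp
    rw [this]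
    simp only [he, inner_smul_right, inner_sub_right, real_inner_comm (h (c y)) (x : F), hhy]
    by_cases hc : c x = c y
    · rw [if_pos hc, if_pos hc.symm]
      linear_combination (a x * a y * inner ℝ (x : F) (y : F) - a x ^ 2 / 3) * hs3sq - ha x
    · rw [if_neg hc, if_neg (Ne.symm hc)]
      linear_combination (a x * a y * inner ℝ (x : F) (y : F)) * hs3sq
  have hY_mem : ∀ y : Y, (y : F) ∈ X := fun y => (Finset.mem_filter.1 y.2).1
  have hsign : ∀ x y : Y, x ≠ y → a x * a y * inner ℝ (x : F) (y : F) = 1 / 3 ∨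
      a x * a y * inner ℝ (x : F) (y : F) = -(1 / 3) := by
    intro x y hxy
    have h1 := hX x (hY_mem x) y (hY_mem y) fun h => hxy (Subtype.ext h)
    rcases sq_eq_one_iff.1 (ha x) with h2 | h2 <;>
      rcases sq_eq_one_iff.1 (ha y) with h3 | h3 <;>
      rcases h1 with h1 | h1 <;> rw [h1, h2, h3] <;> norm_num
  set W := Submodule.span ℝ (Set.range h) with hW
  set U := Submodule.span ℝ (Set.range e) with hU
  have hWrank : Module.finrank ℝ W = 3 := by
    have hli : LinearIndependent ℝ h := by
      refine linearIndependent_of_ne_zero_of_inner_eq_zero (fun j hj => ?_) fun j k hjk => ?_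
      · have := hhh j j
        rw [hj] at this
        norm_num at this
      · exact (hhh j k).trans (if_neg hjk)
    rw [hW, finrank_span_eq_card hli, Fintype.card_fin]
  have hhX : ∀ j, h j ∈ Submodule.span ℝ (X : Set F) := fun j => add_mem (hspan _) (hspan _)
  have hpW : ∀ i, p i ∈ W := by
    have hh' : ∀ j, h j ∈ W := fun j => Submodule.subset_span ⟨j, rfl⟩
    have h0 : p 0 ∈ W := by
      have : p 0 = (1 / 2 : ℝ) • (h 0 + h 1 + h 2) := by
        have h3 : h 0 + h 1 + h 2 = (2 : ℝ) • p 0 + (p 0 + p 1 + p 2 + p 3) := by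
          simp only [hh, two_smul]
          rw [show (0 : Fin 3).succ = 1 from rfl, show (1 : Fin 3).succ = 2 from rfl,
            show (2 : Fin 3).succ = 3 from rfl]
          abel
        rw [h3, hsum, add_zero, smul_smul]
        norm_num
      rw [this]
      exact Submodule.smul_mem _ _ (add_mem (add_mem (hh' _) (hh' _)) (hh' _))
    intro i
    refine Fin.cases h0 (fun j => ?_) i
    have : p j.succ = h j - p 0 := by simp [hh]
    rw [this]
    exact sub_mem (hh' j) h0
  have hXWU : Submodule.span ℝ (X : Set F) = W ⊔ U := by
    apply le_antisymm
    · rw [Submodule.span_le]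
      intro x hx
      rcases hXp x hx with ⟨i, hi | hi⟩ | hx'
      · rw [hi]
        exact Submodule.mem_sup_left (hpW i)
      · rw [hi]
        exact Submodule.mem_sup_left (neg_mem (hpW i))
      · set y : Y := ⟨x, Finset.mem_filter.2 ⟨hx, hx'⟩⟩ with hy
        have : x = (a y * (1 / 2)) • h (c y) + (a y * s3 / 3) • e y := by
          simp only [he, smul_sub, smul_smul]
          rw [show a y * s3 / 3 * (s3 * a y) = 1 by linear_combination a y ^ 2 / 3 * hs3sq + ha y,
            show a y * s3 / 3 * (s3 * (1 / 2)) = a y * (1 / 2) by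
              linear_combination a y / 6 * hs3sq]
          simp [hy]
        rw [this]
        exact add_mem (Submodule.mem_sup_left (Submodule.smul_mem _ _
          (Submodule.subset_span ⟨_, rfl⟩))) (Submodule.mem_sup_right (Submodule.smul_mem _ _
          (Submodule.subset_span ⟨_, rfl⟩)))
    · refine sup_le ?_ ?_ <;> rw [Submodule.span_le]
      · rintro _ ⟨j, rfl⟩
        exact hhX j
      · rintro _ ⟨y, rfl⟩
        exact Submodule.smul_mem _ _ (sub_mem (Submodule.smul_mem _ _
          (Submodule.subset_span (hY_mem y))) (Submodule.smul_mem _ _ (hhX _)))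
  have hWU : W ⟂ U := by
    rw [hW, hU, Submodule.isOrtho_span]
    rintro _ ⟨j, rfl⟩ _ ⟨y, rfl⟩
    exact hhe j y
  have hdim := Submodule.finrank_sup_add_finrank_inf_eq W U
  rw [hWU.disjoint.eq_bot, finrank_bot, ← hXWU, hWrank] at hdim
  have hYcard := card_le_two_mul_finrank_span (e := e) (c := c)
    (fun y => by
      rw [hee, if_pos rfl, hunit _ (hY_mem y)]
      linear_combination 3 * ha y)
    (fun x y hxy hc => by
      rw [hee, if_pos hc]
      rcases hsign x y hxy with h | h <;> rw [h] <;> norm_num)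
    (fun x y hc => by
      rw [hee, if_neg hc]
      rcases hsign x y (fun h => hc (by rw [h])) with h | h <;> rw [h] <;> norm_num)
    (show 5 ≤ Module.finrank ℝ U by omega)
  have hcard := Finset.card_filter_add_card_filter_not (s := X) (fun x => ∀ i,
    inner ℝ (p i) x = (1 / 3 : ℝ) ∨ inner ℝ (p i) x = (-(1 / 3) : ℝ))
  rw [Fintype.card_coe, ← hU] at hYcard
  rw [← hY] at hcard
  omega

lemma eq_of_inner_eq_one {x y : F} (hx : inner ℝ x x = (1 : ℝ)) (hy : inner ℝ y y = (1 : ℝ))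
    (h : inner ℝ x y = (1 : ℝ)) : y = x := by
  rw [← sub_eq_zero, ← inner_self_eq_zero (𝕜 := ℝ)]
  simp only [inner_sub_left, inner_sub_right, hx, hy, h, real_inner_comm x y]
  norm_num

/-- Unit vectors with pairwise inner products `±α` in which no triple has negative product of
inner products are linearly independent. -/
lemma linearIndependent_of_no_negative_triple {X : Finset F} {α : ℝ} (hα0 : 0 < α) (hα1 : α < 1)
    (hunit : ∀ x ∈ X, inner ℝ x x = (1 : ℝ))
    (hX : ∀ x ∈ X, ∀ y ∈ X, x ≠ y → inner ℝ x y = α ∨ inner ℝ x y = -α)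
    (htri : ∀ x ∈ X, ∀ y ∈ X, ∀ z ∈ X, x ≠ y → x ≠ z → y ≠ z →
      0 ≤ (inner ℝ x y * inner ℝ x z * inner ℝ y z : ℝ)) :
    LinearIndependent ℝ (fun x : X => (x : F)) := by
  classical
  rcases X.eq_empty_or_nonempty with rfl | ⟨x₀, hx₀⟩
  · exact linearIndependent_empty_type
  have hαne : α ≠ 0 := hα0.ne'
  obtain ⟨s, hs, hsX⟩ : ∃ s : F → ℝ, (∀ x ∈ X, s x ^ 2 = 1) ∧
      ∀ x ∈ X, ∀ y ∈ X, x ≠ y → inner ℝ x y = s x * s y * α := by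
    -- The signs switch every vector to inner product `+α` with `x₀`; the absence of negative
    -- triples then makes all inner products `+α`, so the Gram matrix becomes `(1 - α)I + αJ`.
    refine ⟨fun y => if y = x₀ then 1 else inner ℝ x₀ y / α, fun x hx => ?_, fun x hx y hy hxy => ?_⟩
    · dsimp only
      split_ifs with h
      · norm_num
      · rcases hX x₀ hx₀ x hx (Ne.symm h) with h' | h' <;> rw [h'] <;> field_simp
    · dsimp only
      by_cases hx0 : x = x₀
      · rw [if_pos hx0, if_neg fun h => hxy (hx0.trans h.symm), hx0]
        field_simp
      by_cases hy0 : y = x₀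
      · rw [if_pos hy0, if_neg hx0, hy0, real_inner_comm x₀ x]
        field_simp
      · rw [if_neg hx0, if_neg hy0]
        have h := htri x₀ hx₀ x hx y hy (Ne.symm hx0) (Ne.symm hy0) hxy
        have h3 : 0 < α * α * α := by positivity
        rcases hX x₀ hx₀ x hx (Ne.symm hx0) with h1 | h1 <;>
          rcases hX x₀ hx₀ y hy (Ne.symm hy0) with h2 | h2 <;>
          rcases hX x hx y hy hxy with h4 | h4 <;> rw [h1, h2, h4] at h <;>
          rw [h1, h2, h4] <;> first | (exfalso; linarith) | (field_simp)
  rw [linearIndependent_iff']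
  intro t g hg
  have hval : ∀ j ∈ t, (1 - α) * g j = - (α * s j * ∑ i ∈ t, g i * s i) := by
    intro j hj
    have h0 : inner ℝ (∑ i ∈ t, g i • (i : F)) (j : F) = (0 : ℝ) := by rw [hg, inner_zero_left]
    have hterm : ∀ i ∈ t, inner ℝ (g i • (i : F)) (j : F) =
        α * s j * (g i * s i) + if i = j then (1 - α) * g j else 0 := by
      intro i _
      rw [inner_smul_left]
      split_ifs with hij
      · rw [hij, hunit _ j.2, RCLike.conj_to_real]
        linear_combination (-(α * g j)) * hs j j.2
      · rw [hsX i i.2 j j.2 fun h => hij (Subtype.ext h), RCLike.conj_to_real]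
        ring
    rw [sum_inner, Finset.sum_congr rfl hterm, Finset.sum_add_distrib, ← Finset.mul_sum,
      Finset.sum_ite_eq' t j, if_pos hj] at h0
    linarith
  set T := ∑ i ∈ t, g i * s i with hT
  have hT0 : T = 0 := by
    have h1 : (1 - α) * T = - (α * T * t.card) := by
      rw [hT, Finset.mul_sum, ← hT]
      have : ∀ j ∈ t, (1 - α) * (g j * s j) = -(α * T) := by
        intro j hj
        linear_combination s j * hval j hj - (α * T) * hs j j.2
      rw [Finset.sum_congr rfl this, Finset.sum_const, nsmul_eq_mul]
      ring
    have h2 : (1 - α + α * t.card) * T = 0 := by linear_combination h1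
    have h3 : 0 < 1 - α + α * t.card := by
      have : 0 ≤ α * t.card := by positivity
      linarith
    exact (mul_eq_zero.1 h2).resolve_left h3.ne'
  intro i hi
  have := hval i hi
  rw [hT0, mul_zero, neg_zero] at this
  exact (mul_eq_zero.1 this).resolve_left (by linarith)

/-- After sign changes the triple has all inner products `-1/3`, so it is three vertices of a
regular tetrahedron. The fourth, minus their sum, lies in the span though perhaps not in `X`. -/
theorem card_le_of_negative_triple [FiniteDimensional ℝ F] {X : Finset F}
    (hunit : ∀ x ∈ X, inner ℝ x x = (1 : ℝ))
    (hX : ∀ x ∈ X, ∀ y ∈ X, x ≠ y → inner ℝ x y = (1 / 3 : ℝ) ∨ inner ℝ x y = (-(1 / 3) : ℝ))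
    {x y z : F} (hx : x ∈ X) (hy : y ∈ X) (hz : z ∈ X) (hxy : x ≠ y) (hxz : x ≠ z) (hyz : y ≠ z)
    (htri : (inner ℝ x y * inner ℝ x z * inner ℝ y z : ℝ) < 0)
    (hrank : 8 ≤ Module.finrank ℝ (Submodule.span ℝ (X : Set F))) :
    X.card ≤ 2 * Module.finrank ℝ (Submodule.span ℝ (X : Set F)) - 2 := by
  have hsub : ∀ v ∈ X, v ∈ Submodule.span ℝ (X : Set F) := fun v hv => Submodule.subset_span hv
  obtain ⟨q, r, hq, hr, hqq, hrr, hxq, hxr, hqr⟩ : ∃ q r : F, (q = y ∨ q = -y) ∧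
      (r = z ∨ r = -z) ∧ inner ℝ q q = (1 : ℝ) ∧ inner ℝ r r = (1 : ℝ) ∧
      inner ℝ x q = (-(1 / 3) : ℝ) ∧ inner ℝ x r = (-(1 / 3) : ℝ) ∧
      inner ℝ q r = (-(1 / 3) : ℝ) := by
    rcases hX x hx y hy hxy with h1 | h1 <;> rcases hX x hx z hz hxz with h2 | h2 <;>
      rcases hX y hy z hz hyz with h3 | h3 <;> rw [h1, h2, h3] at htri <;>
      first
      | (exfalso; linarith)
      | refine ⟨y, z, Or.inl rfl, Or.inl rfl, hunit y hy, hunit z hz, h1, h2, h3⟩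
      | refine ⟨-y, z, Or.inr rfl, Or.inl rfl, ?_, hunit z hz, ?_, h2, ?_⟩ <;>
          simp only [inner_neg_left, inner_neg_right, neg_neg, h1, h3, hunit y hy]
      | refine ⟨y, -z, Or.inl rfl, Or.inr rfl, hunit y hy, ?_, h1, ?_, ?_⟩ <;>
          simp only [inner_neg_left, inner_neg_right, neg_neg, h2, h3, hunit z hz]
      | refine ⟨-y, -z, Or.inr rfl, Or.inr rfl, ?_, ?_, ?_, ?_, ?_⟩ <;>
          simp only [inner_neg_left, inner_neg_right, neg_neg, h1, h2, h3, hunit y hy,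
            hunit z hz]
  have hxx := hunit x hx
  have hqmem : q ∈ Submodule.span ℝ (X : Set F) := by
    rcases hq with rfl | rfl
    · exact hsub _ hy
    · exact neg_mem (hsub _ hy)
  have hrmem : r ∈ Submodule.span ℝ (X : Set F) := by
    rcases hr with rfl | rfl
    · exact hsub _ hz
    · exact neg_mem (hsub _ hz)
  have hww : inner ℝ (-(x + q + r)) (-(x + q + r)) = (1 : ℝ) := by
    simp only [inner_neg_left, inner_neg_right, inner_add_left, inner_add_right, hxx, hqq, hrr,
      hxq, hxr, hqr, real_inner_comm x q, real_inner_comm x r, real_inner_comm q r]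
    norm_num
  refine card_le_of_tetrahedron hunit hX (p := ![x, q, r, -(x + q + r)]) ?_ ?_ ?_ ?_ hrank
  · intro i k
    fin_cases i <;> fin_cases k <;>
      simp [inner_neg_left, inner_neg_right, inner_add_left, inner_add_right, -neg_add_rev,
        -inner_self_eq_norm_sq_to_K, hxx, hqq, hrr,
        hxq, hxr, hqr, real_inner_comm x q, real_inner_comm x r, real_inner_comm q r] <;>
      norm_num
  · simp
  · intro i
    fin_cases i
    · exact hsub x hx
    · exact hqmem
    · exact hrmem
    · exact neg_mem (add_mem (add_mem (hsub x hx) hqmem) hrmem)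
  · intro v hv
    by_cases hvx : v = x
    · exact Or.inl ⟨0, Or.inl hvx⟩
    by_cases hvy : v = y
    · refine Or.inl ⟨1, ?_⟩
      rcases hq with h | h <;> simp [h, hvy]
    by_cases hvz : v = z
    · refine Or.inl ⟨2, ?_⟩
      rcases hr with h | h <;> simp [h, hvz]
    have h1 := hX x hx v hv (Ne.symm hvx)
    have h2 : inner ℝ q v = (1 / 3 : ℝ) ∨ inner ℝ q v = (-(1 / 3) : ℝ) := by
      rcases hq with h | h <;> rcases hX y hy v hv (Ne.symm hvy) with h' | h' <;>
        simp only [h, inner_neg_left, h', neg_neg] <;> simp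
    have h3 : inner ℝ r v = (1 / 3 : ℝ) ∨ inner ℝ r v = (-(1 / 3) : ℝ) := by
      rcases hr with h | h <;> rcases hX z hz v hv (Ne.symm hvz) with h' | h' <;>
        simp only [h, inner_neg_left, h', neg_neg] <;> simp
    -- Minus a sum of three terms `±1/3` is `±1/3` or `±1`, and `±1` between unit vectors means
    -- equal or opposite.
    have h4 : (v = -(x + q + r) ∨ v = - -(x + q + r)) ∨
        (inner ℝ (-(x + q + r)) v = (1 / 3 : ℝ) ∨ inner ℝ (-(x + q + r)) v = (-(1 / 3) : ℝ)) := by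
      have hw : inner ℝ (-(x + q + r)) v = -(inner ℝ x v + inner ℝ q v + inner ℝ r v : ℝ) := by
        rw [inner_neg_left, inner_add_left, inner_add_left]
      have hpos : inner ℝ (-(x + q + r)) v = (1 : ℝ) → v = -(x + q + r) :=
        eq_of_inner_eq_one hww (hunit v hv)
      have hneg : inner ℝ (-(x + q + r)) v = (-1 : ℝ) → v = - -(x + q + r) := by
        intro h
        rw [← neg_eq_iff_eq_neg]
        exact eq_of_inner_eq_one hww (by rw [inner_neg_left, inner_neg_right, neg_neg, hunit v hv]) (by rw [inner_neg_right, h, neg_neg])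
      rcases h1 with h1 | h1 <;> rcases h2 with h2 | h2 <;> rcases h3 with h3 | h3 <;>
        rw [h1, h2, h3] at hw <;>
        first
        | exact Or.inl (Or.inl (hpos (by linarith)))
        | exact Or.inl (Or.inr (hneg (by linarith)))
        | exact Or.inr (Or.inl (by linarith))
        | exact Or.inr (Or.inr (by linarith))
    rcases h4 with h4 | h4
    · exact Or.inl ⟨3, h4⟩
    · right
      intro i
      fin_cases i
      · exact h1
      · exact h2
      · exact h3
      · exact h4

/-- An equiangular set with angle `arccos (1/3)` and rank `r ≥ 8` has at most `2 (r - 1)`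
elements. -/
theorem card_le_of_inner_eq_third [FiniteDimensional ℝ F] {X : Finset F}
    (hunit : ∀ x ∈ X, inner ℝ x x = (1 : ℝ))
    (hX : ∀ x ∈ X, ∀ y ∈ X, x ≠ y → inner ℝ x y = (1 / 3 : ℝ) ∨ inner ℝ x y = (-(1 / 3) : ℝ))
    (hrank : 8 ≤ Module.finrank ℝ (Submodule.span ℝ (X : Set F))) :
    X.card ≤ 2 * Module.finrank ℝ (Submodule.span ℝ (X : Set F)) - 2 := by
  by_cases htri : ∀ x ∈ X, ∀ y ∈ X, ∀ z ∈ X, x ≠ y → x ≠ z → y ≠ z →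
      0 ≤ (inner ℝ x y * inner ℝ x z * inner ℝ y z : ℝ)
  · have hli := linearIndependent_of_no_negative_triple (by norm_num) (by norm_num) hunit hX htri
    have := finrank_span_finset_eq_card (s := X) hli
    omega
  · push Not at htri
    obtain ⟨x, hx, y, hy, z, hz, hxy, hxz, hyz, h⟩ := htri
    exact card_le_of_negative_triple hunit hX hx hy hz hxy hxz hyz h hrank

end Tetrahedron

/-! ### Arithmetic of Seidel matrices: minimal polynomials and parity. -/

section IntegerMatrices

open Polynomial

/-- A minimal polynomial has only simple roots, so each factor `X - x` of an integer polynomial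
costs a full factor `minpoly ℤ x`. This converts eigenvalue multiplicity into a degree bound. -/
lemma minpoly_pow_dvd {x : ℝ} (hx : IsIntegral ℤ x) {f : ℤ[X]} {k : ℕ}
    (hf : (X - C x) ^ k ∣ f.map (Int.castRingHom ℝ)) : minpoly ℤ x ^ k ∣ f := by
  induction k generalizing f with
  | zero => simp
  | succ k ih =>
    set P := minpoly ℤ x with hP
    have hPmonic : P.Monic := minpoly.monic hx
    have haeval : ∀ g : ℤ[X], aeval x g = (g.map (Int.castRingHom ℝ)).eval x := by
      intro g
      rw [aeval_def, eval_map]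
      rfl
    have hroot : aeval x f = 0 := by
      rw [haeval]
      exact dvd_iff_isRoot.1 ((dvd_pow_self _ k.succ_ne_zero).trans hf)
    obtain ⟨g, rfl⟩ := minpoly.isIntegrallyClosed_dvd hx hroot
    have hPx : (X - C x) ∣ P.map (Int.castRingHom ℝ) := by
      rw [dvd_iff_isRoot, IsRoot, ← haeval]
      exact minpoly.aeval ℤ x
    obtain ⟨R, hR⟩ := hPx
    have hRx : R.eval x ≠ 0 := by
      intro h
      have hder : aeval x (derivative P) = 0 := by
        rw [haeval, ← derivative_map, hR, derivative_mul, eval_add, eval_mul, eval_mul, h]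
        simp
      have hdvd : P ∣ derivative P := minpoly.isIntegrallyClosed_dvd hx hder
      have hpos : 0 < P.natDegree := minpoly.natDegree_pos hx
      have hne : derivative P ≠ 0 := by
        intro h0
        have := derivative_eq_zero.1 h0
        omega
      have := natDegree_le_of_dvd hdvd hne
      have := natDegree_derivative_lt hpos.ne'
      omega
    rw [Polynomial.map_mul, ← hP, hR, pow_succ', mul_assoc] at hf
    have hf' := (mul_dvd_mul_iff_left (X_sub_C_ne_zero x)).1 hf
    have hcop : IsCoprime ((X - C x) ^ k) R := by
      apply IsCoprime.pow_left
      refine (irreducible_X_sub_C x).coprime_iff_not_dvd.2 fun h => hRx ?_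
      exact dvd_iff_isRoot.1 h
    rw [pow_succ']
    exact mul_dvd_mul_left _ (ih (hcop.dvd_of_dvd_mul_left hf'))

/-- A symmetric integer matrix with zero diagonal and entries `±1` off the diagonal. -/
structure IsSeidel {ι : Type*} (S : Matrix ι ι ℤ) : Prop where
  symm : ∀ i j, S i j = S j i
  diag : ∀ i, S i i = 0
  off : ∀ i j, i ≠ j → S i j = 1 ∨ S i j = -1

namespace IsSeidel

lemma isHermitian {ι : Type*} {S : Matrix ι ι ℤ} (hS : IsSeidel S) :
    (S.map (Int.cast : ℤ → ℝ)).IsHermitian := by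
  ext i j
  simp [hS.symm i j]

lemma sq_entry {ι : Type*} [DecidableEq ι] {S : Matrix ι ι ℤ} (hS : IsSeidel S) (i j : ι) :
    S i j ^ 2 = if i = j then 0 else 1 := by
  split_ifs with h
  · rw [h, hS.diag]; norm_num
  · rcases hS.off i j h with h | h <;> rw [h] <;> norm_num

variable {ι : Type*} [Fintype ι] [DecidableEq ι] {S : Matrix ι ι ℤ}

lemma sum_sq_row (hS : IsSeidel S) (i : ι) : ∑ j, S i j ^ 2 = Fintype.card ι - 1 := by
  simp only [hS.sq_entry]
  rw [Finset.sum_ite, Finset.sum_const_zero, zero_add, Finset.sum_const, Finset.filter_ne,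
    Finset.card_erase_of_mem (Finset.mem_univ _), Finset.card_univ, nsmul_eq_mul, mul_one,
    Nat.cast_sub (Fintype.card_pos_iff.2 ⟨i⟩)]
  simp

/-- A Seidel matrix of odd order has no even integer as an eigenvalue of multiplicity two. -/
lemma odd_of_two_le_finrank_eigenspace (hS : IsSeidel S) (hodd : Odd (Fintype.card ι)) {l : ℤ}
    (h : 2 ≤ Module.finrank ℝ
      (Module.End.eigenspace (Matrix.toLin' (S.map (Int.cast : ℤ → ℝ))) (l : ℝ))) : Odd l := by
  by_contra hl
  rw [Int.not_odd_iff_even] at hl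
  have hl2 : (l : ZMod 2) = 0 := (ZMod.intCast_zmod_eq_zero_iff_dvd l 2).2 (even_iff_two_dvd.1 hl)
  obtain ⟨i₀⟩ : Nonempty ι := Fintype.card_pos_iff.1 hodd.pos
  set K := Module.End.eigenspace (Matrix.toLin' (S.map (Int.cast : ℤ → ℝ))) (l : ℝ) with hK
  -- Multiplicity two leaves room for an eigenvector vanishing at `i₀`, which survives the deletion
  -- of row and column `i₀`.
  have hker : LinearMap.ker ((LinearMap.proj i₀ : (ι → ℝ) →ₗ[ℝ] ℝ).comp K.subtype) ≠ ⊥ := by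
    apply LinearMap.ker_ne_bot_of_finrank_lt
    rw [Module.finrank_self]
    omega
  obtain ⟨⟨v, hvK⟩, hv0, hvne⟩ := Submodule.exists_mem_ne_zero_of_ne_bot hker
  have hv0' : v i₀ = 0 := hv0
  have hvS : ∀ i, ∑ j, (S i j : ℝ) * v j = l * v i := by
    intro i
    have := congrFun (Module.End.mem_eigenspace_iff.1 hvK) i
    simpa [Matrix.mulVec, dotProduct] using this
  set M : Matrix {i // i ≠ i₀} {i // i ≠ i₀} ℤ :=
    Matrix.of fun i j => S i j - if i = j then l else 0 with hM
  have hMmul : (M.map (Int.cast : ℤ → ℝ)).mulVec (fun j => v j) = 0 := by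
    ext i
    have hi := hvS i
    have hsub : ∑ j ∈ Finset.univ.erase i₀, (S i j : ℝ) * v j =
        ∑ j : {j // j ≠ i₀}, (S i j : ℝ) * v j := Finset.sum_subtype _ (by simp) _
    rw [← Finset.sum_erase_add _ _ (Finset.mem_univ i₀), hv0', mul_zero, add_zero,
      hsub] at hi
    simp only [Matrix.mulVec, dotProduct, Matrix.map_apply, hM, Matrix.of_apply, Pi.zero_apply,
      Int.cast_sub, sub_mul, Finset.sum_sub_distrib, hi]
    simp
  -- For even `l` the matrix is `J - I` modulo 2, of even order, and so its square is the identity.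
  have hdet : M.det ≠ 0 := by
    intro h0
    have hmap : (M.map (Int.castRingHom (ZMod 2))).det = 0 := by
      rw [← RingHom.mapMatrix_apply, ← RingHom.map_det, h0, map_zero]
    have hentry : ∀ i j, M.map (Int.castRingHom (ZMod 2)) i j = 1 - if i = j then 1 else 0 := by
      intro i j
      simp only [hM, Matrix.map_apply, Matrix.of_apply, eq_intCast, Int.cast_sub]
      by_cases hij : i = j
      · simp [hij, hS.diag, hl2]
      · rcases hS.off i j fun h => hij (Subtype.ext h) with h' | h' <;> simp [hij, h']
    have hcard : ((Fintype.card {i // i ≠ i₀} : ℕ) : ZMod 2) = 0 := by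
      rw [ZMod.natCast_eq_zero_iff]
      have : Fintype.card {i // i ≠ i₀} = Fintype.card ι - 1 := by
        rw [Fintype.card_subtype_compl]
        simp
      rw [this]
      obtain ⟨k, hk⟩ := hodd
      exact ⟨k, by omega⟩
    have hsq : M.map (Int.castRingHom (ZMod 2)) * M.map (Int.castRingHom (ZMod 2)) = 1 := by
      ext i j
      rw [Matrix.mul_apply]
      simp only [hentry, sub_mul, mul_sub, Finset.sum_sub_distrib, one_mul, mul_one]
      simp only [Finset.sum_const, Finset.card_univ, nsmul_eq_mul, hcard,
        Finset.sum_ite_eq, Finset.sum_ite_eq', Finset.mem_univ, if_true, mul_ite, mul_one, mul_zero,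
        Matrix.one_apply]
      split_ifs <;> decide
    have := congrArg Matrix.det hsq
    rw [Matrix.det_mul, hmap, Matrix.det_one, zero_mul] at this
    exact zero_ne_one this
  have hdetR : (M.map (Int.cast : ℤ → ℝ)).det ≠ 0 := by
    have : (M.map (Int.cast : ℤ → ℝ)).det = (M.det : ℝ) := by
      have := (Int.castRingHom ℝ).map_det M
      rw [RingHom.mapMatrix_apply] at this
      exact this.symm
    rw [this]
    exact_mod_cast hdet
  have hzero := Matrix.eq_zero_of_mulVec_eq_zero hdetR hMmul
  apply hvne
  apply Subtype.ext
  ext i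
  by_cases hi : i = i₀
  · rw [hi]
    exact hv0'
  · exact congrFun hzero ⟨i, hi⟩

/-- A Seidel matrix whose order is `3` modulo `4` has no kernel vector with entries `±1`. -/
lemma not_mulVec_sign_eq_zero (hS : IsSeidel S) {m : ℕ} (hm : Odd m)
    (hcard : Fintype.card ι = 2 * m + 1) {ε : ι → ℤ} (hε : ∀ i, ε i = 1 ∨ ε i = -1)
    (h : ∀ i, ∑ j, S i j * ε j = 0) : False := by
  -- After switching by `ε`, all row sums vanish, so the `+1` entries form the adjacency matrix of
  -- an `m`-regular graph on `2m + 1` vertices. The sum is twice its number of ordered adjacent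
  -- pairs, a multiple of 4; but `2m(2m + 1)` is `2` modulo 4 for odd `m`.
  have htot : ∑ p : ι × ι, (1 + ε p.1 * S p.1 p.2 * ε p.2 - if p.1 = p.2 then 1 else 0) =
      (2 * m + 1) * (2 * m : ℤ) := by
    rw [Fintype.sum_prod_type]
    have : ∀ i, ∑ j, (1 + ε i * S i j * ε j - if i = j then 1 else 0) = (2 * m : ℤ) := by
      intro i
      rw [Finset.sum_sub_distrib, Finset.sum_add_distrib]
      have h2 : ∑ j, ε i * S i j * ε j = 0 := by
        simp only [mul_assoc]
        rw [← Finset.mul_sum, h, mul_zero]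
      rw [h2]
      simp [hcard]
    rw [Finset.sum_congr rfl fun i _ => this i]
    simp [hcard]
  have hzero : ∑ p : ι × ι,
      ((1 + ε p.1 * S p.1 p.2 * ε p.2 - if p.1 = p.2 then 1 else 0 : ℤ) : ZMod 4) = 0 := by
    have hval : ∀ i j, (1 + ε i * S i j * ε j - if i = j then 1 else 0 : ℤ) = 0 ∨
        (i ≠ j ∧ (1 + ε i * S i j * ε j - if i = j then 1 else 0 : ℤ) = 2) := by
      intro i j
      by_cases hij : i = j
      · left
        simp [hij, hS.diag]
      · rcases hS.off i j hij with h1 | h1 <;> rcases hε i with h2 | h2 <;>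
          rcases hε j with h3 | h3 <;> simp [hij, h1, h2, h3]
    refine Finset.sum_involution (fun p _ => p.swap) ?_ ?_ ?_ ?_
    · rintro ⟨i, j⟩ _
      have hsymm : (1 + ε j * S j i * ε i - if j = i then 1 else 0 : ℤ) =
          1 + ε i * S i j * ε j - if i = j then 1 else 0 := by
        rw [hS.symm j i]
        simp only [eq_comm (a := j)]
        ring
      simp only [Prod.swap, hsymm]
      rcases hval i j with h1 | h1
      · rw [h1]; rfl
      · rw [h1.2]; rfl
    · rintro ⟨i, j⟩ _ hne heq
      rcases hval i j with h1 | h1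
      · exact hne (by rw [h1]; rfl)
      · exact h1.1 (congrArg Prod.snd heq)
    · intro p _
      exact Finset.mem_univ _
    · intro p _
      exact Prod.swap_swap p
  rw [← Int.cast_sum, htot, ZMod.intCast_zmod_eq_zero_iff_dvd] at hzero
  obtain ⟨k, rfl⟩ := hm
  obtain ⟨q, hq⟩ := hzero
  push_cast at hq
  ring_nf at hq
  omega

end IsSeidel

end IntegerMatrices

/-! ### Eigenvalues of large multiplicity. -/

section Spectrum

open Polynomial

variable {ι : Type*} [Fintype ι] [DecidableEq ι]

/-- Parseval for a coordinate vector and a row of `A`: these are the diagonal entries of `1`, `A`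
and `A²` in the eigenbasis. -/
lemma Matrix.IsHermitian.sum_sq_eigenvectorBasis {A : Matrix ι ι ℝ} (hA : A.IsHermitian) (i : ι) :
    ∑ k, hA.eigenvectorBasis k i ^ 2 = 1 ∧
      ∑ k, hA.eigenvalues k * hA.eigenvectorBasis k i ^ 2 = A i i ∧
      ∑ k, hA.eigenvalues k ^ 2 * hA.eigenvectorBasis k i ^ 2 = ∑ j, A i j ^ 2 := by
  set u := hA.eigenvectorBasis with hu
  set a : EuclideanSpace ℝ ι := EuclideanSpace.single i 1 with ha
  set b : EuclideanSpace ℝ ι := WithLp.toLp 2 (A i) with hb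
  have hau : ∀ k, inner ℝ (u k) a = u k i := by
    intro k
    simp [ha, EuclideanSpace.inner_single_right]
  have hbu : ∀ k, inner ℝ (u k) b = hA.eigenvalues k * u k i := by
    intro k
    have h := congrFun (hA.mulVec_eigenvectorBasis k) i
    simp only [Matrix.mulVec, dotProduct, Pi.smul_apply, smul_eq_mul] at h
    rw [← hu] at h
    rw [← h, PiLp.inner_apply]
    simp [hb]
  have hab : ∀ x y : EuclideanSpace ℝ ι,
      ∑ k, inner ℝ (u k) x * inner ℝ (u k) y = (inner ℝ x y : ℝ) := by
    intro x y
    rw [← u.sum_inner_mul_inner x y]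
    exact Finset.sum_congr rfl fun k _ => by rw [real_inner_comm x]
  refine ⟨?_, ?_, ?_⟩
  · have h := hab a a
    simp only [hau] at h
    simp only [sq, h]
    simp [ha]
  · have h := hab a b
    simp only [hau, hbu] at h
    have h' : inner ℝ a b = A i i := by simp [ha, hb, EuclideanSpace.inner_single_left]
    rw [← h', ← h]
    exact Finset.sum_congr rfl fun k _ => by ring
  · have h := hab b b
    simp only [hbu] at h
    have h' : inner ℝ b b = ∑ j, A i j ^ 2 := by
      rw [PiLp.inner_apply]
      exact Finset.sum_congr rfl fun j _ => by simp [hb, sq]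
    rw [← h', ← h]
    exact Finset.sum_congr rfl fun k _ => by ring

namespace IsSeidel

variable {S : Matrix ι ι ℤ}

lemma sum_sq_eigenvectorBasis (hS : IsSeidel S) (i : ι) :
    ∑ k, hS.isHermitian.eigenvectorBasis k i ^ 2 = 1 ∧
      ∑ k, hS.isHermitian.eigenvalues k * hS.isHermitian.eigenvectorBasis k i ^ 2 = 0 ∧
      ∑ k, hS.isHermitian.eigenvalues k ^ 2 * hS.isHermitian.eigenvectorBasis k i ^ 2 =
        Fintype.card ι - 1 := by
  obtain ⟨h1, h2, h3⟩ := hS.isHermitian.sum_sq_eigenvectorBasis i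
  refine ⟨h1, ?_, ?_⟩
  · rw [h2, Matrix.map_apply, hS.diag, Int.cast_zero]
  · rw [h3]
    have := hS.sum_sq_row i
    simp only [Matrix.map_apply]
    exact_mod_cast this

lemma sum_eigenvalues (hS : IsSeidel S) :
    ∑ k, hS.isHermitian.eigenvalues k = 0 ∧
      ∑ k, hS.isHermitian.eigenvalues k ^ 2 =
        Fintype.card ι * (Fintype.card ι - 1 : ℝ) := by
  have hnorm : ∀ k, ∑ i, hS.isHermitian.eigenvectorBasis k i ^ 2 = 1 := by
    intro k
    have h := hS.isHermitian.eigenvectorBasis.orthonormal.1 k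
    have h2 := EuclideanSpace.norm_sq_eq (hS.isHermitian.eigenvectorBasis k)
    rw [h] at h2
    simpa using h2.symm
  have hswap : ∀ f : ι → ℝ, ∑ i, ∑ k, f k * hS.isHermitian.eigenvectorBasis k i ^ 2 =
      ∑ k, f k := by
    intro f
    rw [Finset.sum_comm]
    exact Finset.sum_congr rfl fun k _ => by rw [← Finset.mul_sum, hnorm, mul_one]
  constructor
  · rw [← hswap]
    exact Finset.sum_eq_zero fun i _ => (hS.sum_sq_eigenvectorBasis i).2.1
  · rw [← hswap, Finset.sum_congr rfl fun i _ => (hS.sum_sq_eigenvectorBasis i).2.2]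
    simp [mul_sub]

lemma charpoly_map (S : Matrix ι ι ℤ) : (S.map (Int.cast : ℤ → ℝ)).charpoly =
    S.charpoly.map (Int.castRingHom ℝ) :=
  Matrix.charpoly_map S (Int.castRingHom ℝ)

lemma pow_dvd_charpoly (S : Matrix ι ι ℤ) {m : ℕ} {x : ℝ}
    (h : m ≤ Module.finrank ℝ
      (Module.End.eigenspace (Matrix.toLin' (S.map (Int.cast : ℤ → ℝ))) x)) :
    (X - C x) ^ m ∣ S.charpoly.map (Int.castRingHom ℝ) := by
  have h1 := h.trans (LinearMap.finrank_eigenspace_le _ x)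
  rw [Matrix.charpoly_toLin', charpoly_map] at h1
  exact (le_rootMultiplicity_iff ((S.charpoly_monic.map _).ne_zero)).1 h1

/-- The relative bound, for an eigenvalue of multiplicity `m` of a Seidel matrix of order
`2 m + 1`. -/
lemma sq_le_of_le_finrank_eigenspace (hS : IsSeidel S) {m : ℕ} (hm : 0 < m)
    (hcard : Fintype.card ι = 2 * m + 1) {x : ℝ}
    (h : m ≤ Module.finrank ℝ
      (Module.End.eigenspace (Matrix.toLin' (S.map (Int.cast : ℤ → ℝ))) x)) :
    x ^ 2 ≤ 2 * m + 2 := by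
  set eig := hS.isHermitian.eigenvalues with heig
  have hcount : m ≤ (Finset.univ.filter fun k => eig k = x).card := by
    have h1 := h.trans (LinearMap.finrank_eigenspace_le _ x)
    rw [Matrix.charpoly_toLin', ← count_roots, hS.isHermitian.roots_charpoly_eq_eigenvalues,
      Multiset.count_map] at h1
    refine h1.trans (le_of_eq ?_)
    rw [Finset.card_def, Finset.filter_val]
    congr 1
    exact Multiset.filter_congr fun k _ => by simp [heig, eq_comm]
  set T := Finset.univ.filter fun k => eig k ≠ x with hT
  have hTcard : T.card ≤ m + 1 := by
    have := Finset.card_filter_add_card_filter_not (s := Finset.univ) (fun k => eig k = x)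
    rw [Finset.card_univ, hcard] at this
    simp only [hT, ne_eq]
    omega
  have hsumT : ∀ f : ℝ → ℝ, f 0 = 0 → ∑ k ∈ T, f (eig k - x) = ∑ k, f (eig k - x) := by
    intro f hf
    rw [hT, Finset.sum_filter]
    refine Finset.sum_congr rfl fun k _ => ?_
    split_ifs with hk
    · rfl
    · rw [not_ne_iff.1 hk, sub_self, hf]
  obtain ⟨hs1, hs2⟩ := hS.sum_eigenvalues
  rw [← heig] at hs1 hs2
  rw [hcard] at hs2
  push_cast at hs2
  -- Cauchy–Schwarz on the at most `m + 1` nonzero shifted eigenvalues; their two power sums are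
  -- known from the traces of `S` and `S²`.
  have hcs := sq_sum_le_card_mul_sum_sq (s := T) (f := fun k => eig k - x)
  rw [hsumT (fun t => t) rfl, hsumT (fun t => t ^ 2) (by norm_num)] at hcs
  have e1 : ∑ k, (eig k - x) = - ((2 * m + 1) * x) := by
    rw [Finset.sum_sub_distrib, hs1]
    simp [hcard]
  have e2 : ∑ k, (eig k - x) ^ 2 = (2 * m + 1) * (2 * m) + (2 * m + 1) * x ^ 2 := by
    simp only [sub_sq, Finset.sum_add_distrib, Finset.sum_sub_distrib, hs2, ← Finset.sum_mul,
      ← Finset.mul_sum, hs1]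
    simp [hcard]
  rw [e1, e2] at hcs
  have hTcard' : (T.card : ℝ) ≤ m + 1 := by exact_mod_cast hTcard
  have hm' : (0 : ℝ) < m := by exact_mod_cast hm
  have h3 : (T.card : ℝ) * ((2 * m + 1) * (2 * m) + (2 * m + 1) * x ^ 2) ≤
      (m + 1) * ((2 * m + 1) * (2 * m) + (2 * m + 1) * x ^ 2) :=
    mul_le_mul_of_nonneg_right hTcard' (by positivity)
  have h4 : (2 * m + 1) * m * (x ^ 2 - (2 * m + 2)) ≤ (0 : ℝ) := by linarith [hcs.trans h3]
  have h5 : (0 : ℝ) < (2 * m + 1) * m := by positivity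
  by_contra hlt
  have := mul_pos h5 (sub_pos.2 (not_le.1 hlt))
  linarith

end IsSeidel

namespace IsSeidel

variable {S : Matrix ι ι ℤ}

/-- If the spectrum of a Seidel matrix consists of two conjugate quadratic irrationals and a simple
integer eigenvalue, then the matrix has an eigenvector with entries `±1` for the latter. -/
lemma exists_sign_eigenvector (hS : IsSeidel S) {x y : ℝ} {c : ℤ} {m : ℕ}
    (hcx : (c : ℝ) ≠ x) (hcy : (c : ℝ) ≠ y)
    (hf : ∀ f : ℝ → ℝ, ∑ k, f (hS.isHermitian.eigenvalues k) = m * f x + m * f y + f c)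
    (hmem : ∀ k, hS.isHermitian.eigenvalues k = x ∨ hS.isHermitian.eigenvalues k = y ∨
      hS.isHermitian.eigenvalues k = c) :
    ∃ ε : ι → ℤ, (∀ i, ε i = 1 ∨ ε i = -1) ∧ ∀ i, ∑ j, S i j * ε j = c * ε i := by
  set eig := hS.isHermitian.eigenvalues with heig
  set u := hS.isHermitian.eigenvectorBasis with hu
  have hcount : (Finset.univ.filter fun k => eig k = c).card = 1 := by
    have := hf fun t => if t = c then 1 else 0
    rw [if_neg hcx.symm, if_neg hcy.symm, if_pos rfl, Finset.sum_boole] at this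
    have h1 : (((Finset.univ.filter fun k => eig k = c).card : ℕ) : ℝ) = (1 : ℕ) := by
      rw [this]
      simp
    exact_mod_cast h1
  obtain ⟨k₀, hk₀⟩ := Finset.card_eq_one.1 hcount
  have hk : ∀ k, eig k = c ↔ k = k₀ := fun k => by simpa using Finset.ext_iff.1 hk₀ k
  set w : ι → ℝ := fun i => u k₀ i with hw
  set t : ℝ := (Fintype.card ι - 1 + x * y) / ((c - x) * (c - y)) with ht
  have hcne : ((c : ℝ) - x) * (c - y) ≠ 0 := mul_ne_zero (sub_ne_zero.2 hcx) (sub_ne_zero.2 hcy)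
  -- The product `(S - x)(S - y)` annihilates every eigenvector but the one for `c`, and its
  -- diagonal is constant because `S` and `S²` have constant diagonals.
  have hwt : ∀ i, w i ^ 2 = t := by
    intro i
    obtain ⟨h1, h2, h3⟩ := hS.sum_sq_eigenvectorBasis i
    have h4 : ∑ k, (eig k - x) * (eig k - y) * u k i ^ 2 = (c - x) * (c - y) * w i ^ 2 := by
      rw [Finset.sum_eq_single k₀]
      · rw [(hk k₀).2 rfl]
      · intro k _ hkk
        rcases hmem k with h | h | h
        · rw [h]; ring
        · rw [h]; ring
        · exact absurd ((hk k).1 h) hkk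
      · intro h
        exact absurd (Finset.mem_univ _) h
    have h5 : ∑ k, (eig k - x) * (eig k - y) * u k i ^ 2 = Fintype.card ι - 1 + x * y := by
      have : ∀ k, (eig k - x) * (eig k - y) * u k i ^ 2 =
          eig k ^ 2 * u k i ^ 2 - (x + y) * (eig k * u k i ^ 2) + x * y * u k i ^ 2 := by
        intro k
        ring
      simp only [this, Finset.sum_add_distrib, Finset.sum_sub_distrib, ← Finset.mul_sum]
      rw [h1, h2, h3]
      ring
    rw [ht, eq_div_iff hcne, mul_comm, ← h4, h5]
  have htpos : 0 < t := by
    obtain ⟨i, hi⟩ : ∃ i, w i ≠ 0 := by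
      by_contra hcon
      push Not at hcon
      exact u.orthonormal.ne_zero k₀ (by ext i; exact hcon i)
    rw [← hwt i]
    positivity
  have hr : Real.sqrt t ≠ 0 := (Real.sqrt_pos.2 htpos).ne'
  have hsign : ∀ i, ∃ ε : ℤ, (ε = 1 ∨ ε = -1) ∧ w i = Real.sqrt t * ε := by
    intro i
    have h : w i ^ 2 = Real.sqrt t ^ 2 := by rw [hwt, Real.sq_sqrt htpos.le]
    rcases sq_eq_sq_iff_eq_or_eq_neg.1 h with h | h
    · exact ⟨1, Or.inl rfl, by rw [h]; simp⟩
    · exact ⟨-1, Or.inr rfl, by rw [h]; simp⟩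
  choose ε hε hwε using hsign
  refine ⟨ε, hε, fun i => ?_⟩
  have h := congrFun (hS.isHermitian.mulVec_eigenvectorBasis k₀) i
  simp only [Matrix.mulVec, dotProduct, Pi.smul_apply, smul_eq_mul, Matrix.map_apply] at h
  rw [← hu, ← heig, (hk k₀).2 rfl] at h
  have h' : ∑ j, (S i j : ℝ) * w j = c * w i := h
  simp only [hwε, mul_left_comm _ (Real.sqrt t), ← Finset.mul_sum] at h'
  have h2 := mul_left_cancel₀ hr h'
  exact_mod_cast h2

/-- An eigenvalue of multiplicity at least `m` of a Seidel matrix of order `2 m + 1`, with `m ≥ 3`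
odd, is an odd integer. -/
theorem exists_odd_eq_of_le_finrank_eigenspace (hS : IsSeidel S) {m : ℕ} (hm : Odd m) (hm3 : 3 ≤ m)
    (hcard : Fintype.card ι = 2 * m + 1) {x : ℝ}
    (h : m ≤ Module.finrank ℝ
      (Module.End.eigenspace (Matrix.toLin' (S.map (Int.cast : ℤ → ℝ))) x)) :
    ∃ l : ℤ, Odd l ∧ x = l := by
  suffices hint : ∃ l : ℤ, x = l by
    obtain ⟨l, rfl⟩ := hint
    exact ⟨l, hS.odd_of_two_le_finrank_eigenspace (by rw [hcard]; exact odd_two_mul_add_one m)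
      (by omega), rfl⟩
  have hdvd := pow_dvd_charpoly S h
  have haeval : ∀ g : ℤ[X], aeval x g = (g.map (Int.castRingHom ℝ)).eval x := by
    intro g
    rw [aeval_def, eval_map]
    rfl
  have hxint : IsIntegral ℤ x := by
    refine ⟨S.charpoly, S.charpoly_monic, ?_⟩
    rw [← aeval_def, haeval]
    exact dvd_iff_isRoot.1 ((dvd_pow_self _ (by omega)).trans hdvd)
  obtain ⟨g, hg⟩ := minpoly_pow_dvd hxint hdvd
  set P := minpoly ℤ x with hP
  have hPm : P.Monic := minpoly.monic hxint
  have hgm : g.Monic := (hPm.pow m).of_mul_monic_left (hg ▸ S.charpoly_monic)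
  have hdeg : 2 * m + 1 = m * P.natDegree + g.natDegree := by
    rw [← hcard, ← S.charpoly_natDegree_eq_dim, hg, (hPm.pow m).natDegree_mul hgm,
      hPm.natDegree_pow]
  have hPpos : 0 < P.natDegree := minpoly.natDegree_pos hxint
  have hPle : P.natDegree ≤ 2 := by
    by_contra hlt
    have : m * 3 ≤ m * P.natDegree := Nat.mul_le_mul_left m (by omega)
    omega
  have hPx : aeval x P = 0 := minpoly.aeval ℤ x
  rcases (show P.natDegree = 1 ∨ P.natDegree = 2 by omega) with hP1 | hP2
  · rw [hPm.eq_X_add_C hP1] at hPx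
    refine ⟨-P.coeff 0, ?_⟩
    simp at hPx
    push_cast
    linarith
  · by_contra hnint
    have hg1 : g.natDegree = 1 := by
      rw [hP2] at hdeg
      omega
    set p := P.coeff 1 with hp
    set q := P.coeff 0 with hq
    have hPeq : P = X ^ 2 + C p * X + C q := by
      rw [hPm.as_sum, hP2, Finset.sum_range_succ, Finset.sum_range_one]
      simp only [pow_zero, pow_one, mul_one]
      ring
    have hxq : x ^ 2 + p * x + q = 0 := by
      rw [hPeq] at hPx
      simpa using hPx
    set y : ℝ := -p - x with hy
    set c : ℤ := -g.coeff 0 with hc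
    have hgeq : g = X - C c := by
      rw [hgm.eq_X_add_C hg1, hc]
      simp
    have hxy : x * y = q := by rw [hy]; linear_combination -hxq
    have hmapP : P.map (Int.castRingHom ℝ) = (X - C x) * (X - C y) := by
      rw [hPeq]
      simp only [Polynomial.map_add, Polynomial.map_mul, Polynomial.map_pow, map_X,
        Polynomial.map_C, Int.coe_castRingHom]
      rw [show (p : ℝ) = -(x + y) by rw [hy]; ring, ← hxy]
      simp only [C_neg, C_add, C_mul]
      ring
    have hroots : (S.charpoly.map (Int.castRingHom ℝ)).roots =
        m • {x} + m • {y} + {(c : ℝ)} := by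
      rw [hg, hgeq]
      have hne : ((X - C x) * (X - C y)) ^ m * (X - C (c : ℝ)) ≠ 0 :=
        mul_ne_zero (pow_ne_zero _ (mul_ne_zero (X_sub_C_ne_zero _) (X_sub_C_ne_zero _)))
          (X_sub_C_ne_zero _)
      simp only [Polynomial.map_mul, Polynomial.map_pow, hmapP, Polynomial.map_sub, map_X,
        Polynomial.map_C, Int.coe_castRingHom]
      rw [roots_mul hne, roots_pow, roots_mul (mul_ne_zero (X_sub_C_ne_zero _) (X_sub_C_ne_zero _)),
        roots_X_sub_C, roots_X_sub_C, roots_X_sub_C, nsmul_add]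
    rw [← charpoly_map, hS.isHermitian.roots_charpoly_eq_eigenvalues] at hroots
    have hf : ∀ f : ℝ → ℝ, ∑ k, f (hS.isHermitian.eigenvalues k) = m * f x + m * f y + f c := by
      intro f
      have h1 := congrArg (fun s => (s.map f).sum) hroots
      simpa [Multiset.map_map, Multiset.map_nsmul, Multiset.sum_nsmul] using h1
    have hmem : ∀ k, hS.isHermitian.eigenvalues k = x ∨ hS.isHermitian.eigenvalues k = y ∨
        hS.isHermitian.eigenvalues k = c := by
      intro k
      have h1 : hS.isHermitian.eigenvalues k ∈ (m • {x} + m • {y} + {(c : ℝ)} : Multiset ℝ) := by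
        rw [← hroots]
        exact Multiset.mem_map_of_mem _ (Finset.mem_univ_val k)
      have h2 : ∀ a b : ℝ, a ∈ (m • {b} : Multiset ℝ) → a = b := fun a b hab =>
        Multiset.mem_singleton.1 (Multiset.mem_of_mem_nsmul hab)
      rcases Multiset.mem_add.1 h1 with h1 | h1
      · rcases Multiset.mem_add.1 h1 with h1 | h1
        · exact Or.inl (h2 _ _ h1)
        · exact Or.inr (Or.inl (h2 _ _ h1))
      · exact Or.inr (Or.inr (Multiset.mem_singleton.1 h1))
    have hcx : (c : ℝ) ≠ x := fun h => hnint ⟨c, h.symm⟩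
    have hcy : (c : ℝ) ≠ y := by
      intro h
      exact hnint ⟨-p - c, by push_cast; rw [h, hy]; ring⟩
    obtain ⟨ε, hε, hSε⟩ := hS.exists_sign_eigenvector hcx hcy hf hmem
    obtain ⟨hs1, hs2⟩ := hS.sum_eigenvalues
    rw [hf fun t => t] at hs1
    rw [hf fun t => t ^ 2, hcard] at hs2
    have hcp : c = m * p := by
      have : (c : ℝ) = m * p := by rw [hy] at hs1; linear_combination hs1
      exact_mod_cast this
    have hcR : (c : ℝ) = m * p := by rw [hcp]; push_cast; ring
    have hm0 : (m : ℝ) ≠ 0 := by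
      have : m ≠ 0 := by omega
      exact_mod_cast this
    -- The trace of `S²`, divided by `m`, with `c = mp` from the trace of `S`.
    have hq2 : (p : ℝ) ^ 2 - 2 * q + m * p ^ 2 = 4 * m + 2 := by
      push_cast at hs2
      rw [hcR] at hs2
      apply mul_left_cancel₀ hm0
      rw [hy] at hs2
      linear_combination hs2 - 2 * m * hxq
    have hceven : Even c := by
      obtain ⟨i⟩ : Nonempty ι := Fintype.card_pos_iff.1 (by omega)
      have h1 : ((∑ j, S i j * ε j : ℤ) : ZMod 2) = 0 := by
        have hterm : ∀ j, ((S i j * ε j : ℤ) : ZMod 2) = 1 - if i = j then 1 else 0 := by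
          intro j
          by_cases hij : i = j
          · simp [hij, hS.diag]
          · rcases hS.off i j hij with h1 | h1 <;> rcases hε j with h2 | h2 <;>
              simp [h1, h2, hij]
        rw [Int.cast_sum, Finset.sum_congr rfl fun j _ => hterm j, Finset.sum_sub_distrib]
        simp [hcard]
        exact Or.inl (by decide)
      rw [hSε i] at h1
      rw [← ZMod.intCast_eq_zero_iff_even]
      rcases hε i with h2 | h2 <;> rw [h2] at h1 <;> simpa using h1
    have hpeven : Even p := by
      rw [hcp, Int.even_mul] at hceven
      rcases hceven with h1 | h1
      · exact absurd ((Int.even_coe_nat m).1 h1) (Nat.not_even_iff_odd.2 hm)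
      · exact h1
    -- The discriminant `p² - 4q` equals `(2m + 1)(4 - p²)` and is nonzero, since for even `p` a
    -- double root `-p/2` would be an integer. Hence `p = 0` and `c = 0`, and the sign vector lies
    -- in the kernel.
    have hdisc : (0 : ℝ) < (2 * m + 1) * (4 - p ^ 2) := by
      have h1 : (2 * m + 1) * (4 - (p : ℝ) ^ 2) = (2 * x + p) ^ 2 := by
        linear_combination (-4) * hxq - 2 * hq2
      rw [h1]
      have h2 : 2 * x + p ≠ 0 := by
        intro h0
        obtain ⟨r, hr⟩ := hpeven
        refine hnint ⟨-r, ?_⟩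
        rw [hr] at h0
        push_cast at h0 ⊢
        linarith
      positivity
    have hp2 : (p : ℝ) ^ 2 < 4 := by
      have : (0 : ℝ) < 2 * m + 1 := by positivity
      linarith [(mul_pos_iff_of_pos_left this).1 hdisc]
    have hp0 : p = 0 := by
      have h1 : p ^ 2 < 4 := by exact_mod_cast hp2
      obtain ⟨r, hr⟩ := hpeven
      have h2 : p < 2 := by nlinarith
      have h3 : -2 < p := by nlinarith
      omega
    refine hS.not_mulVec_sign_eq_zero hm hcard hε fun i => ?_
    rw [hSε i, hcp, hp0]
    ring

end IsSeidel

end Spectrum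

/-! ### From equiangular sets to Seidel matrices, and the upper bounds. -/

section UpperBounds

lemma linearIndependent_of_pairwise_orthogonal {d : ℕ} {X : Finset (EuclideanSpace ℝ (Fin d))}
    (hX : IsEquiangularWith 0 X) : LinearIndependent ℝ (fun x : X => (x : EuclideanSpace ℝ (Fin d))) := by
  refine linearIndependent_of_ne_zero_of_inner_eq_zero (fun x h => ?_) fun x y hxy => ?_
  · have := hX.1 x x.2
    rw [h, norm_zero] at this
    exact zero_ne_one this
  · have := hX.2 x x.2 y y.2 fun h => hxy (Subtype.ext h)
    simpa using this

/-- An equiangular set of `2 m + 1` vectors and rank at most `m + 1`, with `m` odd, has angle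
`arccos (1/3)`, for `3 ≤ m ≤ 10`. -/
theorem angle_eq_third {d : ℕ} {X : Finset (EuclideanSpace ℝ (Fin d))} {α : ℝ} (hα0 : 0 ≤ α)
    (hα1 : α < 1) (hX : IsEquiangularWith α X) {m : ℕ} (hm : Odd m) (hm3 : 3 ≤ m) (hm10 : m ≤ 10)
    (hcard : X.card = 2 * m + 1) (hrank : vectorRank X ≤ m + 1) : α = 1 / 3 := by
  classical
  -- For `α = 0` the `2m + 1` vectors would be independent, against rank at most `m + 1`.
  have hα : 0 < α := by
    refine lt_of_le_of_ne hα0 fun h => ?_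
    have h1 := finrank_span_finset_eq_card (linearIndependent_of_pairwise_orthogonal (h ▸ hX))
    rw [vectorRank] at hrank
    omega
  have hunit : ∀ x ∈ X, inner ℝ x x = (1 : ℝ) := fun x hx => by
    rw [real_inner_self_eq_norm_sq, hX.1 x hx, one_pow]
  set S : Matrix X X ℤ := Matrix.of fun x y =>
    if x = y then 0 else if inner ℝ (x : EuclideanSpace ℝ (Fin d)) y = α then 1 else -1 with hS
  have hentry : ∀ x y : X, inner ℝ (x : EuclideanSpace ℝ (Fin d)) y =
      (if x = y then 1 else 0) + α * (S x y : ℝ) := by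
    intro x y
    simp only [hS, Matrix.of_apply]
    split_ifs with h1 h2
    · rw [h1, hunit y y.2]
      simp
    · rw [h2]
      simp
    · rcases hX.2 x x.2 y y.2 fun h => h1 (Subtype.ext h) with h | h
      · exact absurd h h2
      · rw [h]
        simp
  have hseidel : IsSeidel S := by
    refine ⟨fun x y => ?_, fun x => by simp [hS], fun x y hxy => ?_⟩
    · simp only [hS, Matrix.of_apply, eq_comm (a := x), real_inner_comm (x : EuclideanSpace ℝ (Fin d))]
    · simp only [hS, Matrix.of_apply, if_neg hxy]
      split_ifs <;> simp
  set L := Fintype.linearCombination ℝ (fun x : X => (x : EuclideanSpace ℝ (Fin d))) with hL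
  -- A linear relation among the vectors is a kernel vector of the Gram matrix `1 + αS`.
  have hker : LinearMap.ker L ≤
      Module.End.eigenspace (Matrix.toLin' (S.map (Int.cast : ℤ → ℝ))) (-(1 / α)) := by
    intro v hv
    rw [LinearMap.mem_ker, hL, Fintype.linearCombination_apply] at hv
    rw [Module.End.mem_eigenspace_iff]
    ext x
    have h := congrArg (fun z => inner ℝ (x : EuclideanSpace ℝ (Fin d)) z) hv
    simp only [inner_sum, inner_smul_right, hentry, inner_zero_right, mul_add, mul_ite, mul_one,
      mul_zero, Finset.sum_add_distrib, Finset.sum_ite_eq, Finset.mem_univ, if_true] at h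
    simp only [Matrix.toLin'_apply, Matrix.mulVec, dotProduct, Matrix.map_apply, Pi.smul_apply,
      smul_eq_mul]
    have h2 : α * ∑ y, (S x y : ℝ) * v y = - v x := by
      rw [Finset.mul_sum, ← sub_eq_zero]
      rw [← h]
      rw [sub_neg_eq_add, add_comm]
      congr 1
      exact Finset.sum_congr rfl fun y _ => by ring
    field_simp
    linarith
  have hrange : LinearMap.range L = Submodule.span ℝ (X : Set (EuclideanSpace ℝ (Fin d))) := by
    rw [hL, Fintype.range_linearCombination]
    simp
  have hdim := LinearMap.finrank_range_add_finrank_ker L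
  rw [hrange, Module.finrank_fintype_fun_eq_card, Fintype.card_coe, hcard] at hdim
  rw [vectorRank] at hrank
  have hmult := Submodule.finrank_mono hker
  have hle : m ≤ Module.finrank ℝ
      (Module.End.eigenspace (Matrix.toLin' (S.map (Int.cast : ℤ → ℝ))) (-(1 / α))) := by omega
  have hcard' : Fintype.card X = 2 * m + 1 := by rw [Fintype.card_coe, hcard]
  obtain ⟨l, hl, hlα⟩ := hseidel.exists_odd_eq_of_le_finrank_eigenspace hm hm3 hcard' hle
  have hsq := hseidel.sq_le_of_le_finrank_eigenspace (by omega) hcard' hle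
  rw [hlα] at hsq
  have hl1 : (l : ℝ) < -1 := by
    rw [← hlα, neg_lt_neg_iff]
    exact (one_lt_div hα).2 hα1
  have hl1' : l < -1 := by exact_mod_cast hl1
  have hsq' : l ^ 2 ≤ 22 := by
    have h1 : (m : ℝ) ≤ 10 := by exact_mod_cast hm10
    have : (l : ℝ) ^ 2 ≤ 22 := by linarith
    exact_mod_cast this
  -- The odd integers below `-1` start with `-3, -5`, and `25 > 22`.
  have hl5 : -5 < l := by nlinarith
  have hl3 : l = -3 := by
    obtain ⟨k, hk⟩ := hl
    omega
  rw [hl3] at hlα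
  push_cast at hlα
  have : 1 / α = 3 := by linarith
  rw [← this, one_div_one_div]

/-- A finite set of vectors contains subsets of the same rank of any cardinality in between. -/
lemma exists_subset_card_eq_vectorRank_eq {d : ℕ} (X : Finset (EuclideanSpace ℝ (Fin d))) {n : ℕ}
    (h1 : vectorRank X ≤ n) (h2 : n ≤ X.card) :
    ∃ Y ⊆ X, Y.card = n ∧ vectorRank Y = vectorRank X := by
  classical
  obtain ⟨t, htX, htspan, hli⟩ := exists_linearIndependent ℝ (X : Set (EuclideanSpace ℝ (Fin d)))
  have htfin : t.Finite := X.finite_toSet.subset htX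
  set B := htfin.toFinset with hB
  have hBX : B ⊆ X := by
    intro x hx
    exact htX (htfin.mem_toFinset.1 hx)
  have hBspan : Submodule.span ℝ (B : Set (EuclideanSpace ℝ (Fin d))) =
      Submodule.span ℝ (X : Set (EuclideanSpace ℝ (Fin d))) := by
    rw [hB, htfin.coe_toFinset, htspan]
  have hBcard : B.card ≤ n := by
    refine le_trans (le_of_eq ?_) h1
    rw [vectorRank, ← htspan, hB, ← Set.ncard_eq_toFinset_card t htfin]
    have hfin := htfin.fintype
    have := finrank_span_set_eq_card hli
    rw [this, Set.ncard_eq_toFinset_card']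
  obtain ⟨Y, hBY, hYX, hYn⟩ := Finset.exists_subsuperset_card_eq hBX hBcard h2
  refine ⟨Y, hYX, hYn, ?_⟩
  have : Submodule.span ℝ (Y : Set (EuclideanSpace ℝ (Fin d))) =
      Submodule.span ℝ (X : Set (EuclideanSpace ℝ (Fin d))) := by
    apply le_antisymm
    · exact Submodule.span_mono (Finset.coe_subset.2 hYX)
    · rw [← hBspan]
      exact Submodule.span_mono (Finset.coe_subset.2 hBY)
  rw [vectorRank, vectorRank, this]

/-- Passing to exactly `2m + 1` vectors of the same rank `r ≤ m + 1` forces the angle, after which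
the bound `2(r - 1) ≤ 2m` is contradicted. -/
theorem card_le_two_mul {d : ℕ} {X : Finset (EuclideanSpace ℝ (Fin d))} (hX : IsEquiangular X)
    {m : ℕ} (hm : Odd m) (hm3 : 3 ≤ m) (hm10 : m ≤ 10) (hrank8 : 8 ≤ vectorRank X)
    (hrank : vectorRank X ≤ m + 1) : X.card ≤ 2 * m := by
  by_contra hlt
  obtain ⟨α, hα0, hα1, hXα⟩ := hX
  obtain ⟨Y, hYX, hYcard, hYrank⟩ := exists_subset_card_eq_vectorRank_eq X (n := 2 * m + 1)
    (by omega) (by omega)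
  have hYα : IsEquiangularWith α Y :=
    ⟨fun x hx => hXα.1 x (hYX hx), fun x hx y hy => hXα.2 x (hYX hx) y (hYX hy)⟩
  have hthird := angle_eq_third hα0 hα1 hYα hm hm3 hm10 hYcard (by omega)
  rw [hthird] at hYα
  have := card_le_of_inner_eq_third (X := Y)
    (fun x hx => by rw [real_inner_self_eq_norm_sq, hYα.1 x hx, one_pow]) hYα.2
    (by rw [vectorRank] at hYrank; omega)
  rw [vectorRank] at hYrank
  omega

end UpperBounds

/-! ### Extremal examples: the tetrahedral pillar and the Paley conference matrix. -/

section Constructions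

/-- Lets the examples live in any convenient finite-dimensional space; an orthonormal basis carries
them to a standard `ℝ^d`. -/
lemma mem_equiangularSizes {F : Type*} [NormedAddCommGroup F] [InnerProductSpace ℝ F]
    [FiniteDimensional ℝ F] {ι : Type*} [Fintype ι] {v : ι → F} {α : ℝ} (hα0 : 0 ≤ α) (hα1 : α < 1)
    (hunit : ∀ i, inner ℝ (v i) (v i) = (1 : ℝ))
    (hv : ∀ i j, i ≠ j → inner ℝ (v i) (v j) = α ∨ inner ℝ (v i) (v j) = -α) :
    Fintype.card ι ∈ equiangularSizes (Module.finrank ℝ (Submodule.span ℝ (Set.range v))) := by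
  classical
  set φ := (stdOrthonormalBasis ℝ F).repr with hφ
  have hinj : Function.Injective fun i => φ (v i) := by
    intro i j hij
    by_contra hne
    have hvv : v i = v j := φ.injective hij
    have h := hunit i
    nth_rewrite 2 [hvv] at h
    rcases hv i j hne with h' | h' <;> rw [h'] at h <;> linarith
  refine ⟨_, Finset.univ.image fun i => φ (v i), ⟨α, hα0, hα1, ?_, ?_⟩, ?_, ?_⟩
  · intro x hx
    obtain ⟨i, -, rfl⟩ := Finset.mem_image.1 hx
    rw [LinearIsometryEquiv.norm_map, ← sq_eq_sq₀ (norm_nonneg _) zero_le_one,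
      ← real_inner_self_eq_norm_sq, hunit, one_pow]
  · intro x hx y hy hxy
    obtain ⟨i, -, rfl⟩ := Finset.mem_image.1 hx
    obtain ⟨j, -, rfl⟩ := Finset.mem_image.1 hy
    rw [LinearIsometryEquiv.inner_map_map]
    exact hv i j fun h => hxy (by rw [h])
  · rw [vectorRank, Finset.coe_image, Finset.coe_univ, Set.image_univ]
    have : Set.range (fun i => φ (v i)) = φ.toLinearEquiv '' Set.range v := by
      rw [← Set.range_comp]
      rfl
    rw [this, ← LinearEquiv.coe_coe, Submodule.span_image]
    exact φ.toLinearEquiv.finrank_map_eq _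
  · rw [Finset.card_image_of_injective _ hinj, Finset.card_univ]

/-- The vertices of a regular tetrahedron in `ℝ³`, multiplied by `√3`. -/
def tetrahedronSign : Fin 4 → Fin 3 → ℤ :=
  ![![1, 1, 1], ![1, -1, -1], ![-1, 1, -1], ![-1, -1, 1]]

/-- Four unit vectors that form a regular tetrahedron and, for each of `k` further dimensions, two
unit vectors over the midpoint of an edge. -/
noncomputable def pillarVector (k : ℕ) : Fin 4 ⊕ (Fin k × Bool) → EuclideanSpace ℝ (Fin 3 ⊕ Fin k)
  | Sum.inl i => WithLp.toLp 2 (Sum.elim (fun a => (tetrahedronSign i a : ℝ) / √3) 0)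
  | Sum.inr (j, b) => WithLp.toLp 2 (Sum.elim ![1 / √3, 0, 0]
      (Pi.single j ((if b then 1 else -1) * (√2 / √3))))

lemma inner_pillarVector (k : ℕ) :
    (∀ x, inner ℝ (pillarVector k x) (pillarVector k x) = (1 : ℝ)) ∧
      ∀ x y, x ≠ y → inner ℝ (pillarVector k x) (pillarVector k y) = (1 / 3 : ℝ) ∨
        inner ℝ (pillarVector k x) (pillarVector k y) = (-(1 / 3) : ℝ) := by
  have h3 : (√3 : ℝ)⁻¹ * (√3)⁻¹ = 1 / 3 := by
    rw [← mul_inv, Real.mul_self_sqrt (by norm_num), one_div]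
  have h23 : √2 / √3 * (√2 / √3) = (2 / 3 : ℝ) := by
    rw [div_mul_div_comm, Real.mul_self_sqrt (by norm_num), Real.mul_self_sqrt (by norm_num)]
  have hll : ∀ i i', inner ℝ (pillarVector k (Sum.inl i)) (pillarVector k (Sum.inl i')) =
      (∑ a, (tetrahedronSign i a * tetrahedronSign i' a : ℤ)) * (1 / 3 : ℝ) := by
    intro i i'
    rw [← h3, Int.cast_sum, Finset.sum_mul]
    simp only [pillarVector, PiLp.inner_apply, Fintype.sum_sum_type, Sum.elim_inl, Sum.elim_inr]
    simp only [Pi.zero_apply, inner_zero_left, Finset.sum_const_zero, add_zero]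
    refine Finset.sum_congr rfl fun a _ => ?_
    simp only [RCLike.inner_apply, RCLike.conj_to_real]
    push_cast
    ring
  have hlr : ∀ i j b, inner ℝ (pillarVector k (Sum.inl i)) (pillarVector k (Sum.inr (j, b))) =
      (tetrahedronSign i 0 : ℝ) * (1 / 3) := by
    intro i j b
    rw [← h3]
    simp only [pillarVector, PiLp.inner_apply, Fintype.sum_sum_type, Sum.elim_inl, Sum.elim_inr,
      Fin.sum_univ_three]
    simp [div_eq_mul_inv]
    ring
  have hrr : ∀ j b j' b', inner ℝ (pillarVector k (Sum.inr (j, b)))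
      (pillarVector k (Sum.inr (j', b'))) =
      (1 / 3 : ℝ) + if j = j' then (if b then 1 else -1) * (if b' then 1 else -1) * (2 / 3) else 0 := by
    intro j b j' b'
    simp only [pillarVector, PiLp.inner_apply, Fintype.sum_sum_type, Sum.elim_inl, Sum.elim_inr,
      Fin.sum_univ_three]
    congr 1
    · simp
    · simp only [Pi.single_apply, RCLike.inner_apply, RCLike.conj_to_real, mul_ite, ite_mul,
        zero_mul, mul_zero, Finset.sum_ite_eq', Finset.mem_univ, if_true, eq_comm (a := j)]
      split_ifs <;> first | linear_combination h23 | linear_combination -h23 | rfl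
  constructor
  · rintro (i | ⟨j, b⟩)
    · rw [hll]
      have : ∀ i, ∑ a, (tetrahedronSign i a * tetrahedronSign i a : ℤ) = 3 := by decide
      rw [this]
      norm_num
    · rw [hrr]
      cases b <;> norm_num
  · have hsign : ∀ i, tetrahedronSign i 0 = 1 ∨ tetrahedronSign i 0 = -1 := by decide
    rintro (i | ⟨j, b⟩) (i' | ⟨j', b'⟩) hne
    · rw [hll]
      have : ∀ i i', i ≠ i' → ∑ a, (tetrahedronSign i a * tetrahedronSign i' a : ℤ) = -1 := by
        decide
      rw [this i i' fun h => hne (by rw [h])]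
      norm_num
    · rw [hlr]
      rcases hsign i with h | h <;> rw [h] <;> norm_num
    · rw [real_inner_comm, hlr]
      rcases hsign i' with h | h <;> rw [h] <;> norm_num
    · rw [hrr]
      by_cases hj : j = j'
      · have hb : b ≠ b' := fun h => hne (by rw [hj, h])
        rw [if_pos hj]
        cases b <;> cases b' <;> simp at hb ⊢ <;> norm_num
      · rw [if_neg hj]
        norm_num

lemma finrank_span_pillarVector (k : ℕ) :
    Module.finrank ℝ (Submodule.span ℝ (Set.range (pillarVector k))) = 3 + k := by
  have h3 : (√3 : ℝ) ≠ 0 := by positivity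
  have h2 : (√2 : ℝ) ≠ 0 := by positivity
  have htop : Submodule.span ℝ (Set.range (pillarVector k)) = ⊤ := by
    rw [eq_top_iff, ← (EuclideanSpace.basisFun (Fin 3 ⊕ Fin k) ℝ).toBasis.span_eq,
      Submodule.span_le]
    have hmem : ∀ x, pillarVector k x ∈ Submodule.span ℝ (Set.range (pillarVector k)) :=
      fun x => Submodule.subset_span ⟨x, rfl⟩
    rintro _ ⟨(a | j), rfl⟩
    · have : (EuclideanSpace.basisFun (Fin 3 ⊕ Fin k) ℝ).toBasis (Sum.inl a) = (√3 / 2) •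
          (pillarVector k (Sum.inl 0) + pillarVector k (Sum.inl a.succ)) := by
        ext (b | b)
        · simp only [pillarVector]
          fin_cases a <;> fin_cases b <;> simp [tetrahedronSign] <;> field_simp <;> norm_num
        · simp [pillarVector]
      rw [this]
      exact Submodule.smul_mem _ _ (add_mem (hmem _) (hmem _))
    · have : (EuclideanSpace.basisFun (Fin 3 ⊕ Fin k) ℝ).toBasis (Sum.inr j) = (√3 / √2 / 2) •
          (pillarVector k (Sum.inr (j, true)) - pillarVector k (Sum.inr (j, false))) := by
        ext (b | b)
        · simp [pillarVector]
        · simp only [pillarVector]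
          by_cases hb : b = j
          · simp [hb]
            field_simp
            norm_num
          · simp [hb]
      rw [this]
      exact Submodule.smul_mem _ _ (sub_mem (hmem _) (hmem _))
  rw [htop, finrank_top, finrank_euclideanSpace]
  simp

theorem pillar_mem_equiangularSizes (k : ℕ) :
    4 + 2 * k ∈ equiangularSizes (3 + k) := by
  have h := mem_equiangularSizes (by norm_num) (by norm_num) (inner_pillarVector k).1
    (inner_pillarVector k).2
  rw [finrank_span_pillarVector] at h
  convert h using 1
  simp
  ring

/-- The Seidel matrix of the Paley conference graph over the field with 17 elements; the last index
is the point at infinity. -/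
def paleyEntry (i j : Fin 18) : ℤ :=
  if i = j then 0 else if i = 17 ∨ j = 17 then 1 else
    if (i.val + 17 - j.val) % 17 ∈ [1, 2, 4, 8, 9, 13, 15, 16] then 1 else -1

/-- `paleyEntry` as a matrix. -/
def paleySeidel : Matrix (Fin 18) (Fin 18) ℤ := Matrix.of paleyEntry

lemma isSeidel_paleySeidel : IsSeidel paleySeidel where
  symm := show ∀ i j, paleyEntry i j = paleyEntry j i by decide +kernel
  diag := show ∀ i, paleyEntry i i = 0 by decide +kernel
  off := show ∀ i j, i ≠ j → paleyEntry i j = 1 ∨ paleyEntry i j = -1 by decide +kernel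

lemma paleySeidel_mul_self : paleySeidel * paleySeidel = 17 := by
  have h : ∀ i j, ∑ k, paleyEntry i k * paleyEntry k j = if i = j then 17 else 0 := by
    decide +kernel
  ext i j
  rw [Matrix.mul_apply]
  refine (h i j).trans ?_
  simp [Matrix.ofNat_apply]

/-- The orthogonal projection onto the larger eigenspace of `paleySeidel`. -/
noncomputable def paleyProjection : Matrix (Fin 18) (Fin 18) ℝ :=
  (1 / 2 : ℝ) • (1 + (1 / √17) • paleySeidel.map (Int.cast : ℤ → ℝ))

lemma paleyProjection_mul_self : paleyProjection * paleyProjection = paleyProjection := by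
  have h : paleySeidel.map (Int.cast : ℤ → ℝ) * paleySeidel.map (Int.cast : ℤ → ℝ) =
      (17 : ℝ) • 1 := by
    have h1 := congrArg (fun M : Matrix (Fin 18) (Fin 18) ℤ => M.map (Int.castRingHom ℝ))
      paleySeidel_mul_self
    simp only [Matrix.map_mul] at h1
    refine h1.trans ?_
    ext i j
    by_cases hij : i = j <;> simp [Matrix.ofNat_apply, hij]
  have hs : (√17 : ℝ) ≠ 0 := by positivity
  have hs2 : (1 / √17 : ℝ) * (1 / √17) * 17 = 1 := by
    field_simp
    norm_num
  rw [paleyProjection, smul_mul_smul_comm, mul_add, add_mul, add_mul, smul_mul_smul_comm, h,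
    smul_smul, hs2]
  simp only [mul_one, one_mul, one_smul]
  rw [show ∀ x : Matrix (Fin 18) (Fin 18) ℝ, 1 + x + (x + 1) = (2 : ℝ) • (1 + x) by
    intro x; rw [two_smul]; abel, smul_smul]
  norm_num

lemma rank_paleyProjection : paleyProjection.rank = 9 := by
  -- The rank of an idempotent is its trace, here `18 / 2` since `paleySeidel` has zero diagonal.
  have hidem : IsIdempotentElem (Matrix.toLin' paleyProjection) := by
    rw [IsIdempotentElem, Module.End.mul_eq_comp, ← Matrix.toLin'_mul, paleyProjection_mul_self]
  have htr := ((LinearMap.isProj_range_iff_isIdempotentElem _).2 hidem).trace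
  rw [Matrix.trace_toLin'_eq] at htr
  have h9 : paleyProjection.trace = 9 := by
    simp [paleyProjection, Matrix.trace, isSeidel_paleySeidel.diag]
    norm_num
  rw [h9] at htr
  rw [Matrix.rank, ← Matrix.toLin'_apply']
  exact_mod_cast htr.symm

/-- The rows of `√2 P`, with `P` the projection, have Gram matrix `2P = 1 + S/√17`, so they are
equiangular with `α = 1/√17` and rank 9. -/
theorem eighteen_mem_equiangularSizes_nine : 18 ∈ equiangularSizes 9 := by
  have hs : (√17 : ℝ) ≠ 0 := by positivity
  have hsymm : ∀ i j, paleyProjection i j = paleyProjection j i := by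
    intro i j
    simp only [paleyProjection, Matrix.smul_apply, Matrix.add_apply, Matrix.map_apply,
      isSeidel_paleySeidel.symm i j, Matrix.one_apply, eq_comm (a := i)]
  have hinner : ∀ i j, inner ℝ (√2 • (WithLp.toLp 2 (paleyProjection i) : EuclideanSpace ℝ (Fin 18)))
      (√2 • (WithLp.toLp 2 (paleyProjection j) : EuclideanSpace ℝ (Fin 18))) =
      (if i = j then 1 else 0) + (1 / √17) * (paleySeidel i j : ℝ) := by
    intro i j
    have h := congrFun (congrFun paleyProjection_mul_self i) j
    rw [Matrix.mul_apply] at h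
    rw [inner_smul_left, inner_smul_right, PiLp.inner_apply, ← mul_assoc, RCLike.conj_to_real,
      Real.mul_self_sqrt (by norm_num)]
    have h2 : ∑ k, inner ℝ ((WithLp.toLp 2 (paleyProjection i) : EuclideanSpace ℝ (Fin 18)) k)
        ((WithLp.toLp 2 (paleyProjection j) : EuclideanSpace ℝ (Fin 18)) k) =
        paleyProjection i j := by
      rw [← h]
      exact Finset.sum_congr rfl fun k _ => by rw [hsymm k j]; simp [mul_comm]
    rw [h2]
    simp only [paleyProjection, Matrix.smul_apply, Matrix.add_apply, Matrix.map_apply,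
      Matrix.one_apply, smul_eq_mul]
    ring
  have hrange : Module.finrank ℝ (Submodule.span ℝ (Set.range fun i : Fin 18 =>
      √2 • (WithLp.toLp 2 (paleyProjection i) : EuclideanSpace ℝ (Fin 18)))) = 9 := by
    have h1 := paleyProjection.rank_eq_finrank_span_row
    rw [rank_paleyProjection] at h1
    set e := ((LinearEquiv.smulOfNeZero ℝ (EuclideanSpace ℝ (Fin 18)) √2
      (by positivity)).symm.trans (WithLp.linearEquiv 2 ℝ (Fin 18 → ℝ))).symm with he
    have h2 : (Set.range fun i : Fin 18 =>
        √2 • (WithLp.toLp 2 (paleyProjection i) : EuclideanSpace ℝ (Fin 18))) =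
        e '' Set.range paleyProjection.row := by
      rw [← Set.range_comp]
      rfl
    rw [h2, ← LinearEquiv.coe_coe, Submodule.span_image, h1]
    exact e.finrank_map_eq _
  have h := mem_equiangularSizes (v := fun i : Fin 18 =>
    √2 • (WithLp.toLp 2 (paleyProjection i) : EuclideanSpace ℝ (Fin 18))) (α := 1 / √17)
    (by positivity)
    (by
      rw [div_lt_one (by positivity)]
      exact Real.lt_sqrt_of_sq_lt (by norm_num))
    (fun i => by rw [hinner, isSeidel_paleySeidel.diag]; simp)
    (fun i j hij => by
      rw [hinner, if_neg hij]
      rcases isSeidel_paleySeidel.off i j hij with h | h <;> rw [h] <;> simp)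
  rw [hrange, Fintype.card_fin] at h
  exact h

end Constructions

theorem mainTheorem4 :
    IsGreatest (equiangularSizes 8) 14 ∧
      IsGreatest (equiangularSizes 9) 18 ∧
      IsGreatest (equiangularSizes 10) 18 := by
  -- In the upper bounds `m` must be odd, so rank 9 uses `m = 9` as rank 10 does, rather than `m =
  -- 8`.
  refine ⟨⟨pillar_mem_equiangularSizes 5, ?_⟩,
    ⟨eighteen_mem_equiangularSizes_nine, ?_⟩,
    ⟨pillar_mem_equiangularSizes 7, ?_⟩⟩
  · rintro n ⟨d, X, hX, hr, rfl⟩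
    exact card_le_two_mul hX (m := 7) (by decide) (by norm_num) (by norm_num) (by omega) (by omega)
  · rintro n ⟨d, X, hX, hr, rfl⟩
    exact card_le_two_mul hX (m := 9) (by decide) (by norm_num) (by norm_num) (by omega) (by omega)
  · rintro n ⟨d, X, hX, hr, rfl⟩
    exact card_le_two_mul hX (m := 9) (by decide) (by norm_num) (by norm_num) (by omega) (by omega)
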